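/- **Game.** Let $X_i\subset\mathbb R^{d_i}$ ($i\in[N]$) be nonempty, convex and compact, and let $f_i:\mathbb R^{d_i}\times\mathbb R^n\to\mathbb R$, $\psi_i:\mathbb R^{d_i}\to\mathbb R^n$, $g_i:\mathbb R^{d_i}\to\mathbb R^m$. Put $\sigma(x)=\frac1N\sum_i\psi_i(x_i)$ and $g(x)=\sum_i g_i(x_i)$ for $x=(x_1,\dots,x_N)$, and $$p_i(x_i,y)=\nabla_1 f_i(x_i,y)+\tfrac{\nabla\psi_i(x_i)}{N}\nabla_2 f_i(x_i,y),\qquad G(x)=\big(p_i(x_i,\sigma(x))\big)_{i\in[N]} .$$ Assume: $f_i$ is differentiable at every point of $X_i\times\mathbb R^n$, and $x_i\mapsto f_i(x_i,\sigma(x))$ is convex on $X_i$ for every fixed $x_{-i}$; each component of $g_i$ is differentiable and convex on $X_i$, and $\|\nabla g_i\|$ is bounded on $X_i$; $\psi_i$ is differentiable and Lipschitz on $X_i$; there is $x\in X_1\times\dots\times X_N$ with $g(x)<0$ componentwise (Slater); $\|p_i(x_i,y)-p_i(x_i,y')\|\le L_f\|y-y'\|$ for all $x_i\in X_i$, $y,y'\in\mathbb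 R^n$; and $G$ is strongly monotone on $X_1\times\dots\times X_N$, i.e. $\langle G(x)-G(x'),x-x'\rangle\ge\mu\|x-x'\|^2$ for some $\mu>0$. Let $x^*$ be the variational generalized Nash equilibrium (vGNE): $x^*$ is feasible ($x_i^*\in X_i$, $g(x^*)\le0$), no player $i$ can lower $f_i(x_i,\sigma(x))$ by changing only $x_i^*$ and remaining feasible, and there is one multiplier $\lambda\in\mathbb R^m_+$ with $0\in p_i(x_i^*,\sigma(x^*))+\nabla g_i(x_i^*)\lambda+\mathbf N_{X_i}(x_i^*)$ for all $i$ and $0\in-g(x^*)+\mathbf N_{\mathbb R^m_+}(\lambda)$, where $\mathbf N$ denotes the normal cone. **Network.** Let $W_t=[w_{ij,t}]$, $t\ge0$, be nonnegative $N\times N$ matrices with positive diagonal and all columns summing to $1$. Assume there is $\underline w\in(0,1)$ such that every positive entry of every $W_t$ is at least $\underline w$, and there is an integer $U>0$ such that for every $t$ the directed graph with edges $(j,i)$ whenever $w_{ij,t+l}>0$ for some $0\le l<U$ is strongly connected. **Samples.** For functions $F_{i,t}:\mathbb R^{d_i}\times\mathbb R^n\times\mathbb R^{q_i}\to\mathbb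 R$ (measurable, and differentiable in the first two variables on $X_i\times\mathbb R^n$) and random vectors $\xi_i$ in $\mathbb R^{q_i}$, let $f_i(x_i,y)=\mathbb E[F_{i,t}(x_i,y,\xi_i)]$ for all $t$, $x_i\in X_i$, $y\in\mathbb R^n$. Put $q_{i,t}(x_i,y,\zeta)=\nabla_1F_{i,t}(x_i,y,\zeta)+\frac{\nabla\psi_i(x_i)}N\nabla_2F_{i,t}(x_i,y,\zeta)$. Let $\xi_{i,t}$ ($i\in[N]$, $t\ge0$) be random vectors on a probability space, $\xi_{i,t}$ distributed as $\xi_i$, and $\mathscr F_t=\sigma\{\xi_{i,s}: i\in[N],\,s<t\}$. Assume that there are $\iota,S>0$ such that for all $t$, $i$ and all $\mathscr F_t$-measurable $x_i$ with values in $X_i$ and $y$ with values in $\mathbb R^n$, almost surely: $\mathbb E[q_{i,t}(x_i,y,\xi_{i,t})\mid\mathscr F_t]=p_i(x_i,y)$; $\mathbb E[\exp(\|q_{i,t}(x_i,y,\xi_{i,t})-p_i(x_i,y)\|^2/\iota^2)\mid\mathscr F_t]\le e$; and $\|q_{i,t}(x_i,y,\xi_{i,t})\|\le S$. **Algorithm.**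 Start from $z_{i,0}=1$, $x_{i,0}\in X_i$ (deterministic), $\mu_{i,0}=0$, $\sigma_{i,0}=\psi_i(x_{i,0})$, and for $t\ge0$ set $$z_{i,t+1}=\sum_j w_{ij,t}z_{j,t},\quad \hat\mu_{i,t}=\sum_j w_{ij,t}\mu_{j,t},\quad \hat\sigma_{i,t}=\sum_j w_{ij,t}\sigma_{j,t},$$ $$s_{i,t+1}=q_{i,t}\Big(x_{i,t},\tfrac{\hat\sigma_{i,t}}{z_{i,t+1}},\xi_{i,t}\Big)+\nabla g_i(x_{i,t})\tfrac{\hat\mu_{i,t}}{z_{i,t+1}},\quad x_{i,t+1}=\Pi_{X_i}[x_{i,t}-\alpha_t s_{i,t+1}],$$ $$\mu_{i,t+1}=[\hat\mu_{i,t}+\gamma_t(g_i(x_{i,t})-\beta_t\hat\mu_{i,t})]_+,\quad \sigma_{i,t+1}=\hat\sigma_{i,t}+\psi_i(x_{i,t+1})-\psi_i(x_{i,t}),$$ with $\alpha_0=\beta_0=\gamma_0=1$ and $\alpha_t=t^{-3/4}$, $\beta_t=\gamma_t=t^{-1/4}$ for $t\ge1$. Let $\bar x_T=\frac1T\sum_{t=1}^T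 x_t$. **Claim.** There is a constant $C$, depending only on the game, the matrices $W_t$, $\iota$ and $S$ (not on $T$, $\delta$, the sampling model or the initial point), such that for every integer $T\ge1$ and every $\delta\in(0,1)$, with probability at least $1-\delta$, $$\|\bar x_T-x^*\|^2\le C\Big(T^{-1/4}+T^{-1/4}\ln\tfrac1\delta\Big).$$ -/

import Mathlib

open MeasureTheory ProbabilityTheory

noncomputable section

/-- The Euclidean space `ℝᵏ`. -/
abbrev Vec (k : ℕ) : Type := EuclideanSpace ℝ (Fin k)

/-- A joint decision `x = col{x_1, …, x_N}` with `x_i ∈ ℝ^{d_i}`. -/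
abbrev Joint {N : ℕ} (d : Fin N → ℕ) : Type := ∀ i, Vec (d i)

/-! ### Convex-analytic notions -/

/-- The componentwise positive part `[v]_+`, i.e. the projection onto the nonnegative orthant. -/
def posPartVec {k : ℕ} (v : Vec k) : Vec k := WithLp.toLp 2 fun j => max (v j) 0

/-- The nonnegative orthant. -/
def orthant (k : ℕ) : Set (Vec k) := {v | ∀ j, 0 ≤ v j}

open Classical in
/-- The Euclidean projection onto `K`: a point of `K` nearest to `u`. It exists and is unique when
`K` is nonempty, closed and convex; the value is `u` if there is no nearest point. -/
def metricProj {k : ℕ} (K : Set (Vec k)) (u : Vec k) : Vec k :=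
  if h : ∃ v ∈ K, ∀ w ∈ K, ‖u - v‖ ≤ ‖u - w‖ then h.choose else u

/-- The normal cone of `K` at `x` (empty if `x ∉ K`). -/
def normalCone {k : ℕ} (K : Set (Vec k)) (x : Vec k) : Set (Vec k) :=
  {v | x ∈ K ∧ ∀ y ∈ K, inner ℝ v (y - x) ≤ 0}

/-- `∇φ(x) v = ∑ⱼ vⱼ ∇φⱼ(x)`: the transposed Jacobian of `φ` at `x`, applied to `v`. -/
def gradMul {a b : ℕ} (φ : Vec a → Vec b) (x : Vec a) (v : Vec b) : Vec a :=
  ContinuousLinearMap.adjoint (fderiv ℝ φ x) v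

/-- `∇₁ h(x, y) + (∇ψ(x) / N) ∇₂ h(x, y)`. -/
def aggGrad (N : ℕ) {a n : ℕ} (ψ : Vec a → Vec n) (h : Vec a → Vec n → ℝ)
    (x : Vec a) (y : Vec n) : Vec a :=
  gradient (fun u => h u y) x + (1 / (N : ℝ)) • gradMul ψ x (gradient (fun v => h x v) y)

/-! ### The time-invariant aggregative game -/

/-- The data of an aggregative game with `N` players: local sets `X_i`, costs `f_i(x_i, σ)`,
contributions `ψ_i` to the aggregate in `ℝⁿ`, and constraint functions `g_i` with values in `ℝᵐ`. -/
structure AggGame (N n m : ℕ) (d : Fin N → ℕ) where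
  X : ∀ i, Set (Vec (d i))
  f : ∀ i, Vec (d i) → Vec n → ℝ
  ψ : ∀ i, Vec (d i) → Vec n
  g : ∀ i, Vec (d i) → Vec m

namespace AggGame

variable {N n m : ℕ} {d : Fin N → ℕ} (Γ : AggGame N n m d)

/-- The aggregate `σ(x) = (1/N) ∑ᵢ ψ_i(x_i)`. -/
def agg (x : Joint d) : Vec n := (1 / (N : ℝ)) • ∑ i, Γ.ψ i (x i)

/-- The coupled constraint function `g(x) = ∑ᵢ g_i(x_i)`. -/
def coupled (x : Joint d) : Vec m := ∑ i, Γ.g i (x i)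

/-- The feasible set `(X_1 × ⋯ × X_N) ∩ {x | g(x) ≤ 0}`. -/
def feasible : Set (Joint d) := {x | (∀ i, x i ∈ Γ.X i) ∧ ∀ j, Γ.coupled x j ≤ 0}

/-- `p_i(x_i, y) = ∇₁ f_i(x_i, y) + (∇ψ_i(x_i) / N) ∇₂ f_i(x_i, y)`. -/
def p (i : Fin N) (x : Vec (d i)) (y : Vec n) : Vec (d i) := aggGrad N (Γ.ψ i) (Γ.f i) x y

/-- The pseudo-gradient `G(x) = col{∇_{x_i} f_i(x_i, σ(x))}`. -/
def G (x : Joint d) : Joint d := fun i => Γ.p i (x i) (Γ.agg x)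

/-- `x` is a generalized Nash equilibrium: it is feasible and no player can lower its own cost by
a unilateral deviation that keeps the joint decision feasible. -/
def IsGNE (x : Joint d) : Prop :=
  x ∈ Γ.feasible ∧ ∀ i, ∀ u : Vec (d i), Function.update x i u ∈ Γ.feasible →
    Γ.f i (x i) (Γ.agg x) ≤ Γ.f i u (Γ.agg (Function.update x i u))

/-- The KKT conditions of all players, with one common multiplier `lam`:
`0 ∈ ∇_{x_i} f_i(x_i, σ(x)) + ∇g_i(x_i) lam + N_{X_i}(x_i)` for every `i`, and
`0 ∈ -g(x) + N_{ℝᵐ₊}(lam)`. -/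
def IsKKT (x : Joint d) (lam : Vec m) : Prop :=
  (∀ i, -(Γ.p i (x i) (Γ.agg x) + gradMul (Γ.g i) (x i) lam) ∈ normalCone (Γ.X i) (x i)) ∧
    Γ.coupled x ∈ normalCone (orthant m) lam

/-- `x` is a variational GNE: a GNE that satisfies the KKT conditions with a multiplier common to
all players. -/
def IsVGNE (x : Joint d) : Prop := Γ.IsGNE x ∧ ∃ lam : Vec m, Γ.IsKKT x lam

/-- The regularity assumptions on the game. -/
structure Regular : Prop where
  nonempty : ∀ i, (Γ.X i).Nonempty
  convex : ∀ i, Convex ℝ (Γ.X i)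
  compact : ∀ i, IsCompact (Γ.X i)
  /-- Slater's condition; in particular the feasible set is nonempty. -/
  slater : ∃ x : Joint d, (∀ i, x i ∈ Γ.X i) ∧ ∀ j, Γ.coupled x j < 0
  diff_f : ∀ i, ∀ x ∈ Γ.X i, ∀ y : Vec n,
    DifferentiableAt ℝ (fun w : Vec (d i) × Vec n => Γ.f i w.1 w.2) (x, y)
  convex_f : ∀ i, ∀ x : Joint d,
    ConvexOn ℝ (Γ.X i) fun u => Γ.f i u (Γ.agg (Function.update x i u))
  diff_g : ∀ i, ∀ x ∈ Γ.X i, DifferentiableAt ℝ (Γ.g i) x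
  convex_g : ∀ i j, ConvexOn ℝ (Γ.X i) fun u => Γ.g i u j
  /-- The gradients of the constraint functions are bounded on the local sets. -/
  bdd_grad_g : ∃ M : ℝ, ∀ i, ∀ x ∈ Γ.X i, ‖fderiv ℝ (Γ.g i) x‖ ≤ M
  diff_ψ : ∀ i, ∀ x ∈ Γ.X i, DifferentiableAt ℝ (Γ.ψ i) x
  lip_ψ : ∃ Lσ : ℝ, 0 < Lσ ∧ ∀ i, ∀ x ∈ Γ.X i, ∀ x' ∈ Γ.X i,
    ‖Γ.ψ i x - Γ.ψ i x'‖ ≤ Lσ * ‖x - x'‖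

/-- `p_i` is Lipschitz continuous in the aggregate, uniformly over the local set. -/
def LipschitzInAgg : Prop :=
  ∃ Lf : ℝ, 0 < Lf ∧ ∀ i, ∀ x ∈ Γ.X i, ∀ y y' : Vec n,
    ‖Γ.p i x y - Γ.p i x y'‖ ≤ Lf * ‖y - y'‖

/-- The pseudo-gradient is strongly monotone on `X_1 × ⋯ × X_N`. -/
def StronglyMonotone : Prop :=
  ∃ c : ℝ, 0 < c ∧ ∀ x x' : Joint d, (∀ i, x i ∈ Γ.X i) → (∀ i, x' i ∈ Γ.X i) →
    c * ∑ i, ‖x i - x' i‖ ^ 2 ≤ ∑ i, inner ℝ (Γ.G x i - Γ.G x' i) (x i - x' i)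

end AggGame

/-! ### The communication graphs -/

/-- The assumptions on the weight matrices `W_t`. The edge `(j, i)` is present at time `t` iff
`0 < W t i j`. -/
structure GraphAssumption {N : ℕ} (W : ℕ → Matrix (Fin N) (Fin N) ℝ) : Prop where
  nonneg : ∀ t i j, 0 ≤ W t i j
  diag_pos : ∀ t i, 0 < W t i i
  lower_bound : ∃ w : ℝ, 0 < w ∧ w < 1 ∧ ∀ t i j, 0 < W t i j → w ≤ W t i j
  column_stochastic : ∀ t j, ∑ i, W t i j = 1
  /-- For some `U > 0`, all unions of the edge sets over `U` consecutive times are strongly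
  connected. -/
  strongly_connected : ∃ U : ℕ, 0 < U ∧ ∀ t, ∀ a b : Fin N,
    Relation.ReflTransGen (fun j i => ∃ l < U, 0 < W (t + l) i j) a b

/-! ### The sampled costs -/

section Sampling

variable {N n m : ℕ} {d k : Fin N → ℕ}

/-- The sampled gradient
`q_{i,t}(x_i, y, ζ) = ∇₁ F_{i,t}(x_i, y, ζ) + (∇ψ_i(x_i) / N) ∇₂ F_{i,t}(x_i, y, ζ)`. -/
def sampledGrad (Γ : AggGame N n m d) (F : ∀ i, ℕ → Vec (d i) → Vec n → Vec (k i) → ℝ)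
    (i : Fin N) (t : ℕ) (x : Vec (d i)) (y : Vec n) (ζ : Vec (k i)) : Vec (d i) :=
  aggGrad N (Γ.ψ i) (fun u v => F i t u v ζ) x y

/-- The costs of the game are the expectations `f_i(x_i, σ) = 𝔼[F_{i,t}(x_i, σ, ξ_i)]`, for every
time `t`, with `F_{i,t}` differentiable in `(x_i, σ)`. -/
structure IsExpectedCost (Γ : AggGame N n m d)
    (F : ∀ i, ℕ → Vec (d i) → Vec n → Vec (k i) → ℝ)
    {Ω₀ : Fin N → Type*} [∀ i, MeasurableSpace (Ω₀ i)] (P₀ : ∀ i, Measure (Ω₀ i))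
    (ξ₀ : ∀ i, Ω₀ i → Vec (k i)) : Prop where
  meas_ξ : ∀ i, Measurable (ξ₀ i)
  meas_F : ∀ i t, Measurable fun w : Vec (d i) × Vec n × Vec (k i) => F i t w.1 w.2.1 w.2.2
  diff_F : ∀ i t, ∀ x ∈ Γ.X i, ∀ (y : Vec n) (ζ : Vec (k i)),
    DifferentiableAt ℝ (fun w : Vec (d i) × Vec n => F i t w.1 w.2 ζ) (x, y)
  integrable : ∀ i t, ∀ x ∈ Γ.X i, ∀ y : Vec n, Integrable (fun ω => F i t x y (ξ₀ i ω)) (P₀ i)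
  cost_eq : ∀ i t, ∀ x ∈ Γ.X i, ∀ y : Vec n, Γ.f i x y = ∫ ω, F i t x y (ξ₀ i ω) ∂(P₀ i)

/-- The σ-algebra `𝓕_t = σ{ξ_{i,s} : i ∈ [N], s < t}`, trivial for `t = 0`. -/
@[reducible] def sampleSigma {Ω : Type*} (ξ : ∀ i, ℕ → Ω → Vec (k i)) (t : ℕ) : MeasurableSpace Ω :=
  ⨆ (i : Fin N) (s : ℕ) (_ : s < t), MeasurableSpace.comap (ξ i s) inferInstance

/-- The assumptions on the sampled gradients, at all `𝓕_t`-measurable `x : Ω → X_i` and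
`y : Ω → ℝⁿ`: conditional unbiasedness, sub-Gaussian noise with parameter `ι`, and an almost sure
bound `S`. -/
structure SamplingAssumption (Γ : AggGame N n m d)
    (F : ∀ i, ℕ → Vec (d i) → Vec n → Vec (k i) → ℝ) (ι S : ℝ)
    {Ω : Type*} [MeasurableSpace Ω] (P : Measure Ω) (ξ : ∀ i, ℕ → Ω → Vec (k i)) : Prop where
  unbiased : ∀ (t : ℕ) (i : Fin N) (x : Ω → Vec (d i)) (y : Ω → Vec n),
    Measurable[sampleSigma ξ t] x → Measurable[sampleSigma ξ t] y → (∀ ω, x ω ∈ Γ.X i) →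
    P[fun ω => sampledGrad Γ F i t (x ω) (y ω) (ξ i t ω) | sampleSigma ξ t]
      =ᵐ[P] fun ω => Γ.p i (x ω) (y ω)
  subgaussian : ∀ (t : ℕ) (i : Fin N) (x : Ω → Vec (d i)) (y : Ω → Vec n),
    Measurable[sampleSigma ξ t] x → Measurable[sampleSigma ξ t] y → (∀ ω, x ω ∈ Γ.X i) →
    P[fun ω => Real.exp
        (‖sampledGrad Γ F i t (x ω) (y ω) (ξ i t ω) - Γ.p i (x ω) (y ω)‖ ^ 2 / ι ^ 2)
        | sampleSigma ξ t]
      ≤ᵐ[P] fun _ => Real.exp 1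
  bounded : ∀ (t : ℕ) (i : Fin N) (x : Ω → Vec (d i)) (y : Ω → Vec n),
    Measurable[sampleSigma ξ t] x → Measurable[sampleSigma ξ t] y → (∀ ω, x ω ∈ Γ.X i) →
    ∀ᵐ ω ∂P, ‖sampledGrad Γ F i t (x ω) (y ω) (ξ i t ω)‖ ≤ S

end Sampling

/-! ### The primal-dual push-sum algorithm -/

/-- The variables of all players at one time. -/
structure PDState {N : ℕ} (n m : ℕ) (d : Fin N → ℕ) where
  z : Fin N → ℝ
  x : Joint d
  mu : Fin N → Vec m
  sig : Fin N → Vec n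

section Algorithm

variable {N n m : ℕ} {d k : Fin N → ℕ}

/-- The initial state for the initial decision `x0`. -/
def pdInit (Γ : AggGame N n m d) (x0 : Joint d) : PDState n m d where
  z := fun _ => 1
  x := x0
  mu := fun _ => 0
  sig := fun i => Γ.ψ i (x0 i)

/-- One update of all players at time `t`, with step sizes `α`, `β`, `γ` and samples `ζ i`. -/
def pdStep (Γ : AggGame N n m d) (F : ∀ i, ℕ → Vec (d i) → Vec n → Vec (k i) → ℝ)
    (W : ℕ → Matrix (Fin N) (Fin N) ℝ) (α β γ : ℕ → ℝ) (t : ℕ) (ζ : ∀ i, Vec (k i))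
    (st : PDState n m d) : PDState n m d :=
  let z' : Fin N → ℝ := fun i => ∑ j, W t i j * st.z j
  let muHat : Fin N → Vec m := fun i => ∑ j, W t i j • st.mu j
  let sigHat : Fin N → Vec n := fun i => ∑ j, W t i j • st.sig j
  let s : Joint d := fun i =>
    sampledGrad Γ F i t (st.x i) ((z' i)⁻¹ • sigHat i) (ζ i)
      + gradMul (Γ.g i) (st.x i) ((z' i)⁻¹ • muHat i)
  let x' : Joint d := fun i => metricProj (Γ.X i) (st.x i - α t • s i)
  { z := z'
    x := x'
    mu := fun i => posPartVec (muHat i + γ t • (Γ.g i (st.x i) - β t • muHat i))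
    sig := fun i => sigHat i + Γ.ψ i (x' i) - Γ.ψ i (st.x i) }

/-- The state at time `t` of the algorithm run on the samples `ζ i t`. -/
def pdRun (Γ : AggGame N n m d) (F : ∀ i, ℕ → Vec (d i) → Vec n → Vec (k i) → ℝ)
    (W : ℕ → Matrix (Fin N) (Fin N) ℝ) (α β γ : ℕ → ℝ) (x0 : Joint d)
    (ζ : ∀ i, ℕ → Vec (k i)) : ℕ → PDState n m d
  | 0 => pdInit Γ x0
  | t + 1 => pdStep Γ F W α β γ t (fun i => ζ i t) (pdRun Γ F W α β γ x0 ζ t)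

/-- The parameter sequence with value `1` at `t = 0` and `1 / t ^ a` for `t ≥ 1`. -/
def polyStep (a : ℝ) (t : ℕ) : ℝ := if t = 0 then 1 else 1 / (t : ℝ) ^ a

/-- The average decision `(1/T) ∑_{t=1}^T x_t`. -/
def avgDecision (x : ℕ → Joint d) (T : ℕ) : Joint d :=
  (1 / (T : ℝ)) • ∑ t ∈ Finset.Icc 1 T, x t

/-- The squared Euclidean distance of two joint decisions in `ℝ^{d_1 + ⋯ + d_N}`. -/
def sqDist (x y : Joint d) : ℝ := ∑ i, ‖x i - y i‖ ^ 2

end Algorithm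

end

/-! Write b_t for the dual step, so that β_t = γ_t = b_t and α_t = b_t³. The core is the pathwise
inequality c ∑_{t≤T} ‖x_t − x*‖² ≤ C ∑_{t≤T} b_t + noise (`AggGame.exists_regret_bound`). Since ∑
b_t = O(T^{3/4}), dividing by T and using convexity of the squared norm gives the rate T^{-1/4}.

One step of it is `IsPrimalDualRun.regret_step`. Strong monotonicity and KKT bound c‖x_t − x*‖² by
⟨G(x_t), x_t − x*⟩ + ⟨λ, g(x_t)⟩. The projected primal step bounds the first product by a difference
of ‖x_t − x*‖² weighted by 1/α_t, minus ∑⟨v_i, g_i(x_{i,t})⟩, where v_i are the multiplier ratios.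
The dual step bounds −∑⟨v_i − λ, g_i(x_{i,t})⟩ by a difference of the potential ∑‖μ_i − z_i λ‖²/z_i
weighted by 1/b_t. Adding the two cancels every term in g(x_t). What remains is quadratic step
errors, disagreement and noise.

All of these are O(b_t) in sum. The regularisation −β_t μ̂ keeps ‖μ_t‖ = O(1/b_t), so the primal
direction is O(1/b_t) and α_t‖s‖² = O(b_t). Summation by parts against 1/b_t³ (bounded distances)
and 1/b_t (potential O(1/b_t²)) costs O(b_t) per step, because 1/b_t grows by at most b_{t+1}³.
Disagreement is controlled by the geometric contraction of push-sum
(`GraphAssumption.exists_consensus`).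

The noise is almost surely a sum of bounded martingale differences, hence O(√T (1 + ln(1/δ))) with
probability at least 1 − δ by an Azuma bound, which is below T^{3/4}. -/

/-! ### Push-sum consensus over time-varying column-stochastic weights. -/

section Network

variable {N : ℕ}

/-- The product `W_{t+k-1} ⋯ W_t`. -/
def transitionMatrix (W : ℕ → Matrix (Fin N) (Fin N) ℝ) (t : ℕ) : ℕ → Matrix (Fin N) (Fin N) ℝ
  | 0 => 1
  | k + 1 => W (t + k) * transitionMatrix W t k

variable {W : ℕ → Matrix (Fin N) (Fin N) ℝ}

lemma transitionMatrix_succ_apply (t k : ℕ) (i j : Fin N) :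
    transitionMatrix W t (k + 1) i j = ∑ l, W (t + k) i l * transitionMatrix W t k l j := by
  simp [transitionMatrix, Matrix.mul_apply]

namespace GraphAssumption

lemma transitionMatrix_nonneg (hW : GraphAssumption W) (t k : ℕ) (i j : Fin N) :
    0 ≤ transitionMatrix W t k i j := by
  induction k generalizing i with
  | zero => simp only [transitionMatrix, Matrix.one_apply]; split_ifs <;> norm_num
  | succ k ih =>
    rw [transitionMatrix_succ_apply]
    exact Finset.sum_nonneg fun l _ => mul_nonneg (hW.nonneg _ _ _) (ih l)

lemma transitionMatrix_col_sum (hW : GraphAssumption W) (t k : ℕ) (j : Fin N) :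
    ∑ i, transitionMatrix W t k i j = 1 := by
  induction k with
  | zero => simp [transitionMatrix, Matrix.one_apply]
  | succ k ih =>
    simp only [transitionMatrix_succ_apply]
    rw [Finset.sum_comm]
    simp only [← Finset.sum_mul, hW.column_stochastic, one_mul, ih]

lemma transitionMatrix_pos_succ (hW : GraphAssumption W) {t k : ℕ} {i l j : Fin N}
    (hil : 0 < W (t + k) i l) (hlj : 0 < transitionMatrix W t k l j) :
    0 < transitionMatrix W t (k + 1) i j := by
  rw [transitionMatrix_succ_apply]
  exact lt_of_lt_of_le (mul_pos hil hlj) (Finset.single_le_sum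
    (f := fun l => W (t + k) i l * transitionMatrix W t k l j)
    (fun l _ => mul_nonneg (hW.nonneg _ _ _) (hW.transitionMatrix_nonneg _ _ _ _))
    (Finset.mem_univ l))

lemma transitionMatrix_pos_mono (hW : GraphAssumption W) {t k k' : ℕ} (h : k ≤ k') {i j : Fin N}
    (hij : 0 < transitionMatrix W t k i j) : 0 < transitionMatrix W t k' i j := by
  induction k', h using Nat.le_induction with
  | base => exact hij
  | succ k' _ ih => exact hW.transitionMatrix_pos_succ (hW.diag_pos _ _) ih

lemma transitionMatrix_diag_pos (hW : GraphAssumption W) (t k : ℕ) (i : Fin N) :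
    0 < transitionMatrix W t k i i :=
  hW.transitionMatrix_pos_mono (Nat.zero_le k) (by simp [transitionMatrix])

lemma pow_le_transitionMatrix (hW : GraphAssumption W) {w : ℝ} (hw0 : 0 < w)
    (hw : ∀ t i j, 0 < W t i j → w ≤ W t i j) (t k : ℕ) (i j : Fin N)
    (h : 0 < transitionMatrix W t k i j) : w ^ k ≤ transitionMatrix W t k i j := by
  induction k generalizing i with
  | zero =>
    simp only [transitionMatrix, Matrix.one_apply] at h ⊢
    split_ifs at h ⊢ <;> simp_all
  | succ k ih =>
    rw [transitionMatrix_succ_apply] at h ⊢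
    obtain ⟨l, -, hl⟩ := Finset.exists_lt_of_sum_lt (f := fun _ => (0 : ℝ))
      (s := Finset.univ) (by simpa using h)
    have h1 : 0 < W (t + k) i l :=
      (hW.nonneg _ _ _).lt_of_ne fun h0 => by simp [← h0] at hl
    have h2 : 0 < transitionMatrix W t k l j :=
      (hW.transitionMatrix_nonneg _ _ _ _).lt_of_ne fun h0 => by simp [← h0] at hl
    calc w ^ (k + 1) = w * w ^ k := pow_succ' _ _
      _ ≤ W (t + k) i l * transitionMatrix W t k l j :=
        mul_le_mul (hw _ _ _ h1) (ih l h2) (by positivity) h1.le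
      _ ≤ _ := Finset.single_le_sum
        (f := fun l => W (t + k) i l * transitionMatrix W t k l j)
        (fun l _ => mul_nonneg (hW.nonneg _ _ _) (hW.transitionMatrix_nonneg _ _ _ _))
        (Finset.mem_univ l)

-- The set of nodes reached from `j` never shrinks, because of the self-loops. If it is unchanged
-- over a window of length `U`, it is closed under all edges of that window, hence is everything by
-- strong connectivity. So it gains a node in each window until full, and `N` windows suffice.
open Classical in
lemma transitionMatrix_pos (hW : GraphAssumption W) {U : ℕ}
    (hU : ∀ t, ∀ a b : Fin N,
      Relation.ReflTransGen (fun j i => ∃ l < U, 0 < W (t + l) i j) a b) (t : ℕ) (i j : Fin N) :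
    0 < transitionMatrix W t (N * U) i j := by
  let R : ℕ → Finset (Fin N) := fun k => Finset.univ.filter fun i => 0 < transitionMatrix W t k i j
  have hmem : ∀ k i, i ∈ R k ↔ 0 < transitionMatrix W t k i j := fun k i => by simp [R]
  have hmono : ∀ {k k'}, k ≤ k' → R k ⊆ R k' := fun h i hi =>
    (hmem _ _).2 (hW.transitionMatrix_pos_mono h ((hmem _ _).1 hi))
  have hgrow : ∀ k, R (k + U) = R k → R k = Finset.univ := by
    intro k hk
    refine Finset.eq_univ_iff_forall.2 fun b => ?_
    have hj : j ∈ R k := (hmem _ _).2 (hW.transitionMatrix_diag_pos _ _ _)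
    induction hU (t + k) j b with
    | refl => exact hj
    | tail _ hbc ih =>
      obtain ⟨l, hl, hpos⟩ := hbc
      have h1 := (hmem _ _).1 (hmono (Nat.le_add_right k l) ih)
      rw [add_assoc] at hpos
      have h2 := hW.transitionMatrix_pos_succ hpos h1
      rw [← hk]
      -- The edge is used at offset `l < U`, so its head is reached after `k + l + 1 ≤ k + U` steps.
      exact hmono (by omega) ((hmem _ _).2 h2)
  have hcard : ∀ s, min N s ≤ (R (s * U)).card := by
    intro s
    induction s with
    | zero => simp
    | succ s ih =>
      by_cases hs : R (s * U + U) = R (s * U)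
      · have h1 := hgrow _ hs
        rw [Nat.succ_mul, hs, h1]
        simp
      · have h1 : R (s * U) ⊂ R (s * U + U) :=
          (hmono (Nat.le_add_right _ _)).ssubset_of_ne fun h => hs h.symm
        have h2 := Finset.card_lt_card h1
        rw [Nat.succ_mul]
        omega
  have h1 := hcard N
  rw [min_self] at h1
  have h2 : R (N * U) = Finset.univ := (Finset.card_eq_iff_eq_univ _).1
    (le_antisymm (Finset.card_le_univ _) (by simpa using h1))
  exact (hmem _ _).1 (h2 ▸ Finset.mem_univ i)

/-- Long enough products of the weight matrices have uniformly positive entries. -/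
lemma exists_le_transitionMatrix (hW : GraphAssumption W) :
    ∃ (K : ℕ) (η : ℝ), 0 < η ∧ (∀ t i j, η ≤ transitionMatrix W t K i j) ∧
      ∀ t k, k ≤ K → ∀ i, η ≤ transitionMatrix W t k i i := by
  obtain ⟨w, hw0, hw1, hw⟩ := hW.lower_bound
  obtain ⟨U, -, hU⟩ := hW.strongly_connected
  refine ⟨N * U, w ^ (N * U), by positivity, fun t i j => ?_, fun t k hk i => ?_⟩
  · exact hW.pow_le_transitionMatrix hw0 hw _ _ _ _ (hW.transitionMatrix_pos hU _ _ _)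
  · exact (pow_le_pow_of_le_one hw0.le hw1.le hk).trans
      (hW.pow_le_transitionMatrix hw0 hw _ _ _ _ (hW.transitionMatrix_diag_pos _ _ _))

end GraphAssumption

lemma sum_norm_sum_smul_le {E : Type*} [NormedAddCommGroup E] [NormedSpace ℝ E]
    {A : Matrix (Fin N) (Fin N) ℝ} (hA : ∀ i j, 0 ≤ A i j) {c : ℝ} (hc : ∀ j, ∑ i, A i j = c)
    (u : Fin N → E) : ∑ i, ‖∑ j, A i j • u j‖ ≤ c * ∑ j, ‖u j‖ := by
  calc ∑ i, ‖∑ j, A i j • u j‖ ≤ ∑ i, ∑ j, A i j * ‖u j‖ :=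
        Finset.sum_le_sum fun i _ => (norm_sum_le _ _).trans_eq (Finset.sum_congr rfl fun j _ => by
          rw [norm_smul, Real.norm_of_nonneg (hA i j)])
    _ = c * ∑ j, ‖u j‖ := by
        rw [Finset.sum_comm]
        simp only [← Finset.sum_mul, hc, Finset.mul_sum]

/-- Subtracting `η` from every entry does not change the action on zero-sum families, but lowers the
column sums to `1 - N * η`. This is the source of the contraction. -/
lemma sum_norm_sum_smul_le_of_sum_eq_zero {E : Type*} [NormedAddCommGroup E] [NormedSpace ℝ E]
    {A : Matrix (Fin N) (Fin N) ℝ} {η : ℝ} (hA : ∀ i j, η ≤ A i j) (hc : ∀ j, ∑ i, A i j = 1)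
    {u : Fin N → E} (hu : ∑ j, u j = 0) :
    ∑ i, ‖∑ j, A i j • u j‖ ≤ (1 - N * η) * ∑ j, ‖u j‖ := by
  have h := sum_norm_sum_smul_le (A := fun i j => A i j - η) (c := 1 - N * η)
    (fun i j => sub_nonneg.2 (hA i j)) (fun j => by simp [Finset.sum_sub_distrib, hc]) u
  simpa only [sub_smul, Finset.sum_sub_distrib, ← Finset.smul_sum, hu, smul_zero, sub_zero] using h

lemma sum_norm_sub_transitionMatrix_le {E : Type*} [NormedAddCommGroup E] [NormedSpace ℝ E]
    (hW : GraphAssumption W) {u : ℕ → Fin N → E} {a : ℕ → ℝ}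
    (h : ∀ t, ∑ i, ‖u (t + 1) i - ∑ j, W t i j • u t j‖ ≤ a t) (t k : ℕ) :
    ∑ i, ‖u (t + k) i - ∑ j, transitionMatrix W t k i j • u t j‖
      ≤ ∑ s ∈ Finset.range k, a (t + s) := by
  induction k with
  | zero => simp [transitionMatrix, Matrix.one_apply, ite_smul]
  | succ k ih =>
    have key : ∀ i, u (t + (k + 1)) i - ∑ j, transitionMatrix W t (k + 1) i j • u t j
        = (u (t + k + 1) i - ∑ l, W (t + k) i l • u (t + k) l)
          + ∑ l, W (t + k) i l • (u (t + k) l - ∑ j, transitionMatrix W t k l j • u t j) := by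
      intro i
      simp only [transitionMatrix_succ_apply, smul_sub, Finset.sum_sub_distrib, Finset.smul_sum,
        smul_smul, Finset.sum_smul]
      rw [Finset.sum_comm (f := fun j l => (W (t + k) i l * transitionMatrix W t k l j) • u t j)]
      abel_nf
    calc _ ≤ ∑ i, (‖u (t + k + 1) i - ∑ l, W (t + k) i l • u (t + k) l‖
          + ‖∑ l, W (t + k) i l • (u (t + k) l - ∑ j, transitionMatrix W t k l j • u t j)‖) :=
          Finset.sum_le_sum fun i _ => by rw [key]; exact norm_add_le _ _
      _ ≤ a (t + k) + ∑ s ∈ Finset.range k, a (t + s) := by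
          rw [Finset.sum_add_distrib]
          refine add_le_add (h _) ((sum_norm_sum_smul_le (hW.nonneg _)
            (hW.column_stochastic _) _).trans ?_)
          rw [one_mul]
          exact ih
      _ = _ := by rw [Finset.sum_range_succ, add_comm]

/-- Summing the contraction over `t < T` puts `(1 - r) * ∑ D` on the right, which is absorbed on the
left. The first `K` terms are estimated by `h0`, and monotonicity of `a` turns each window sum into
`K * a t`. -/
lemma sum_range_le_of_delayed_contraction {D a : ℕ → ℝ} {K : ℕ} {r : ℝ} (hr : 0 < r)
    (hD : ∀ t, 0 ≤ D t) (ha : Antitone a) (ha0 : ∀ t, 0 ≤ a t)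
    (h0 : ∀ t, D t ≤ D 0 + ∑ s ∈ Finset.range t, a s)
    (hK : ∀ t, D (t + K) ≤ (1 - r) * D t + ∑ s ∈ Finset.range K, a (t + s)) (T : ℕ) :
    ∑ t ∈ Finset.range T, D t ≤ ((K + K ^ 2) / r) * (D 0 + ∑ t ∈ Finset.range T, a t) := by
  rcases Nat.eq_zero_or_pos T with rfl | hT
  · simp only [Finset.range_zero, Finset.sum_empty, add_zero]
    have := hD 0
    positivity
  have h1 : ∑ t ∈ Finset.range T, D t ≤ ∑ t ∈ Finset.range (K + T), D t :=
    Finset.sum_le_sum_of_subset_of_nonneg (Finset.range_mono (by omega)) fun t _ _ => hD t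
  rw [Finset.sum_range_add] at h1
  have h2 : ∑ t ∈ Finset.range K, D t ≤ K * (D 0 + K * a 0) := by
    calc ∑ t ∈ Finset.range K, D t ≤ ∑ t ∈ Finset.range K, (D 0 + K * a 0) := by
          refine Finset.sum_le_sum fun t ht => (h0 t).trans ?_
          have : ∑ s ∈ Finset.range t, a s ≤ ∑ s ∈ Finset.range t, a 0 :=
            Finset.sum_le_sum fun s _ => ha (Nat.zero_le s)
          simp only [Finset.sum_const, Finset.card_range, nsmul_eq_mul] at this
          have h3 : (t : ℝ) * a 0 ≤ K * a 0 :=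
            mul_le_mul_of_nonneg_right (by exact_mod_cast (Finset.mem_range.1 ht).le) (ha0 0)
          linarith
      _ = _ := by simp; ring
  have h3 : ∑ t ∈ Finset.range T, D (K + t)
      ≤ (1 - r) * ∑ t ∈ Finset.range T, D t + K * ∑ t ∈ Finset.range T, a t := by
    rw [Finset.mul_sum, Finset.mul_sum, ← Finset.sum_add_distrib]
    refine Finset.sum_le_sum fun t _ => ?_
    have : ∑ s ∈ Finset.range K, a (t + s) ≤ ∑ s ∈ Finset.range K, a t :=
      Finset.sum_le_sum fun s _ => ha (Nat.le_add_right t s)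
    simp only [Finset.sum_const, Finset.card_range, nsmul_eq_mul] at this
    have h4 := hK t
    rw [add_comm t K] at h4
    linarith
  have h4 : a 0 ≤ ∑ t ∈ Finset.range T, a t :=
    Finset.single_le_sum (f := a) (fun t _ => ha0 t) (Finset.mem_range.2 hT)
  rw [div_mul_eq_mul_div, le_div_iff₀ hr]
  have h5 := mul_le_mul_of_nonneg_left h4 (sq_nonneg (K : ℝ))
  have h6 := mul_nonneg (sq_nonneg (K : ℝ)) (hD 0)
  nlinarith

/-- Consensus of the perturbed push-sum iteration, in summed form: if `u` follows `u ↦ W_t u` up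
to perturbations of size `a t`, then the ratios `(W_t u_t)_i / z_{i, t+1}` are close to the mean of
`u_t`. -/
theorem GraphAssumption.exists_consensus (hW : GraphAssumption W) :
    ∃ (zmin C : ℝ), 0 < zmin ∧ 0 ≤ C ∧ ∀ z : ℕ → Fin N → ℝ, (∀ i, z 0 i = 1) →
      (∀ t i, z (t + 1) i = ∑ j, W t i j * z t j) →
      (∀ t i, zmin ≤ z t i) ∧ (∀ t, ∑ i, z t i = N) ∧
      ∀ (E : Type) [NormedAddCommGroup E] [NormedSpace ℝ E] (u : ℕ → Fin N → E) (a : ℕ → ℝ),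
        Antitone a → (∀ t, 0 ≤ a t) →
        (∀ t i, ‖u (t + 1) i - ∑ j, W t i j • u t j‖ ≤ a t) → ∀ T,
        ∑ t ∈ Finset.range T, ∑ i,
            ‖(z (t + 1) i)⁻¹ • (∑ j, W t i j • u t j) - (1 / (N : ℝ)) • ∑ j, u t j‖
          ≤ C * (∑ i, ‖u 0 i‖ + ∑ t ∈ Finset.range T, a t) := by
  obtain ⟨K, η, hη, hηK, hηd⟩ := hW.exists_le_transitionMatrix
  rcases Nat.eq_zero_or_pos N with hN | hN
  · subst hN
    refine ⟨1, 0, one_pos, le_rfl, fun z _ _ => ⟨fun t i => i.elim0, fun t => by simp, ?_⟩⟩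
    intros
    simp
  have hNR : (0 : ℝ) < N := by exact_mod_cast hN
  set C₀ : ℝ := (K + K ^ 2) / (N * η) with hC₀
  have hC₀0 : 0 ≤ C₀ := by positivity
  -- The factor `η⁻¹` pays for dividing by `z`, `C₀` for the delayed contraction with rate `N * η`,
  -- and `2 * N` for passing from `u` to its centred version.
  refine ⟨η, η⁻¹ * C₀ * (2 * N), hη, by positivity, fun z hz0 hz => ?_⟩
  have hzt : ∀ t k i, z (t + k) i = ∑ j, transitionMatrix W t k i j * z t j := by
    intro t k
    induction k with
    | zero => intro i; simp [transitionMatrix, Matrix.one_apply]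
    | succ k ih =>
      intro i
      rw [← add_assoc, hz]
      simp only [ih, transitionMatrix_succ_apply, Finset.mul_sum, Finset.sum_mul]
      rw [Finset.sum_comm]
      simp only [mul_assoc]
  have hz0' : ∀ t i, 0 ≤ z t i := by
    intro t i
    have := hzt 0 t i
    rw [zero_add] at this
    rw [this]
    exact Finset.sum_nonneg fun j _ => mul_nonneg (hW.transitionMatrix_nonneg _ _ _ _) (by simp [hz0])
  have hzsum : ∀ t, ∑ i, z t i = N := by
    intro t
    induction t with
    | zero => simp [hz0]
    | succ t ih =>
      simp only [hz]
      rw [Finset.sum_comm]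
      simp only [← Finset.sum_mul, hW.column_stochastic, one_mul, ih]
  have hzmin : ∀ t i, η ≤ z t i := by
    intro t i
    -- Before time `K` the diagonal entry alone suffices; afterwards the last `K` steps spread the
    -- total mass `N` with weights at least `η`.
    rcases le_total t K with h | h
    · have h1 := hzt 0 t i
      rw [zero_add] at h1
      rw [h1]
      refine (hηd 0 t h i).trans ?_
      simp only [hz0, mul_one]
      exact Finset.single_le_sum (f := fun j => transitionMatrix W 0 t i j)
        (fun j _ => hW.transitionMatrix_nonneg _ _ _ _) (Finset.mem_univ i)
    · obtain ⟨s, rfl⟩ := Nat.exists_eq_add_of_le' h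
      rw [hzt]
      calc η ≤ η * N := le_mul_of_one_le_right hη.le (by exact_mod_cast hN)
        _ = ∑ j, η * z s j := by rw [← Finset.mul_sum, hzsum]
        _ ≤ _ := Finset.sum_le_sum fun j _ => mul_le_mul_of_nonneg_right (hηK _ _ _) (hz0' _ _)
  refine ⟨hzmin, hzsum, ?_⟩
  intro E _ _ u a ha ha0 hu T
  set m : ℕ → E := fun t => (1 / (N : ℝ)) • ∑ j, u t j with hm
  -- Centring by `z t i • m t` instead of `m t` gives a zero-sum family although `W` is not row
  -- stochastic: `z` evolves by the same matrices, so `W` maps `z t • m t` to `z (t + 1) • m t`.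
  set v : ℕ → Fin N → E := fun t i => u t i - z t i • m t with hv
  set D : ℕ → ℝ := fun t => ∑ i, ‖v t i‖ with hD
  have hv0 : ∀ t, ∑ i, v t i = 0 := by
    intro t
    simp only [hv, Finset.sum_sub_distrib, ← Finset.sum_smul, hm, smul_smul, ← Finset.sum_mul]
    rw [hzsum, mul_one_div_cancel hNR.ne', one_smul, sub_self]
  have hWv : ∀ t i, ∑ j, W t i j • v t j = (∑ j, W t i j • u t j) - z (t + 1) i • m t := by
    intro t i
    simp only [hv, smul_sub, Finset.sum_sub_distrib, hz, Finset.sum_smul, smul_smul]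
  have hmstep : ∀ t, m (t + 1) - m t
      = (1 / (N : ℝ)) • ∑ i, (u (t + 1) i - ∑ j, W t i j • u t j) := by
    intro t
    have : ∑ i, ∑ j, W t i j • u t j = ∑ j, u t j := by
      rw [Finset.sum_comm]
      simp only [← Finset.sum_smul, hW.column_stochastic, one_smul]
    rw [Finset.sum_sub_distrib, this, smul_sub]
  have hmnorm : ∀ t, ‖m (t + 1) - m t‖ ≤ a t := by
    intro t
    rw [hmstep, norm_smul, Real.norm_of_nonneg (by positivity), one_div, inv_mul_le_iff₀ hNR]
    refine (norm_sum_le _ _).trans ((Finset.sum_le_sum fun i _ => hu t i).trans ?_)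
    simp
  have hstep : ∀ t, ∑ i, ‖v (t + 1) i - ∑ j, W t i j • v t j‖ ≤ 2 * N * a t := by
    intro t
    calc _ ≤ ∑ i, (a t + z (t + 1) i * a t) := by
          refine Finset.sum_le_sum fun i _ => ?_
          have : v (t + 1) i - ∑ j, W t i j • v t j
              = (u (t + 1) i - ∑ j, W t i j • u t j) - z (t + 1) i • (m (t + 1) - m t) := by
            rw [hWv]
            simp only [hv, smul_sub]
            abel
          rw [this]
          refine (norm_sub_le _ _).trans (add_le_add (hu t i) ?_)
          rw [norm_smul, Real.norm_of_nonneg (hz0' _ _)]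
          exact mul_le_mul_of_nonneg_left (hmnorm t) (hz0' _ _)
      _ = _ := by
          rw [Finset.sum_add_distrib, ← Finset.sum_mul, hzsum]
          simp
          ring
  have hpert := sum_norm_sub_transitionMatrix_le hW hstep
  have hbound : ∀ t k c, ∑ i, ‖∑ j, transitionMatrix W t k i j • v t j‖ ≤ c * D t →
      D (t + k) ≤ c * D t + ∑ s ∈ Finset.range k, 2 * N * a (t + s) := by
    intro t k c hc
    refine le_trans ?_ (add_le_add hc (hpert t k))
    rw [← Finset.sum_add_distrib]
    refine Finset.sum_le_sum fun i _ => ?_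
    have := norm_add_le (∑ j, transitionMatrix W t k i j • v t j)
      (v (t + k) i - ∑ j, transitionMatrix W t k i j • v t j)
    rwa [add_sub_cancel] at this
  have hDsum := sum_range_le_of_delayed_contraction (D := D) (a := fun t => 2 * N * a t) (K := K)
    (r := N * η) (by positivity) (fun t => Finset.sum_nonneg fun i _ => norm_nonneg _)
    (fun s t hst => mul_le_mul_of_nonneg_left (ha hst) (by positivity))
    (fun t => mul_nonneg (by positivity) (ha0 t))
    (fun t => by
      have := hbound 0 t 1 (sum_norm_sum_smul_le (hW.transitionMatrix_nonneg _ _)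
        (hW.transitionMatrix_col_sum _ _) _)
      simpa using this)
    (fun t => hbound t K _ (sum_norm_sum_smul_le_of_sum_eq_zero (hηK t)
        (hW.transitionMatrix_col_sum _ _) (hv0 t))) T
  have hD0 : D 0 ≤ 2 * N * ∑ i, ‖u 0 i‖ := by
    have h1 : ‖m 0‖ ≤ ∑ i, ‖u 0 i‖ := by
      simp only [hm]
      rw [norm_smul, Real.norm_of_nonneg (by positivity), one_div, inv_mul_le_iff₀ hNR]
      refine (norm_sum_le _ _).trans (le_mul_of_one_le_left
        (Finset.sum_nonneg fun i _ => norm_nonneg _) (by exact_mod_cast hN))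
    calc D 0 ≤ ∑ i, (‖u 0 i‖ + ∑ i, ‖u 0 i‖) := by
          refine Finset.sum_le_sum fun i _ => ?_
          simp only [hv, hz0, one_smul]
          exact (norm_sub_le _ _).trans (add_le_add le_rfl h1)
      _ = (1 + N) * ∑ i, ‖u 0 i‖ := by
          rw [Finset.sum_add_distrib]; simp; ring
      _ ≤ _ := by
          refine mul_le_mul_of_nonneg_right ?_ (Finset.sum_nonneg fun i _ => norm_nonneg _)
          have : (1 : ℝ) ≤ N := by exact_mod_cast hN
          linarith
  calc _ ≤ ∑ t ∈ Finset.range T, η⁻¹ * D t := by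
        refine Finset.sum_le_sum fun t _ => ?_
        calc _ ≤ ∑ i, η⁻¹ * ‖∑ j, W t i j • v t j‖ := by
              refine Finset.sum_le_sum fun i _ => ?_
              have hzpos : 0 < z (t + 1) i := hη.trans_le (hzmin _ _)
              have : (z (t + 1) i)⁻¹ • (∑ j, W t i j • u t j) - (1 / (N : ℝ)) • ∑ j, u t j
                  = (z (t + 1) i)⁻¹ • ∑ j, W t i j • v t j := by
                rw [hWv, smul_sub, smul_smul, inv_mul_cancel₀ hzpos.ne', one_smul]
              rw [this, norm_smul, Real.norm_of_nonneg (by positivity)]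
              exact mul_le_mul_of_nonneg_right (inv_anti₀ hη (hzmin _ _)) (norm_nonneg _)
          _ ≤ η⁻¹ * D t := by
              rw [← Finset.mul_sum]
              refine mul_le_mul_of_nonneg_left ?_ (by positivity)
              have := sum_norm_sum_smul_le (hW.nonneg t) (hW.column_stochastic t) (v t)
              rwa [one_mul] at this
    _ = η⁻¹ * ∑ t ∈ Finset.range T, D t := by rw [Finset.mul_sum]
    _ ≤ η⁻¹ * (C₀ * (2 * N * ∑ i, ‖u 0 i‖ + ∑ t ∈ Finset.range T, 2 * N * a t)) := by
        refine mul_le_mul_of_nonneg_left (hDsum.trans ?_) (by positivity)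
        exact mul_le_mul_of_nonneg_left (add_le_add hD0 le_rfl) hC₀0
    _ = _ := by rw [← Finset.mul_sum]; ring

end Network

/-! ### Projections and first-order convexity inequalities. -/

section Convexity

lemma metricProj_spec {k : ℕ} {K : Set (Vec k)} (hne : K.Nonempty) (hK : IsCompact K)
    (u : Vec k) : metricProj K u ∈ K ∧ ∀ w ∈ K, ‖u - metricProj K u‖ ≤ ‖u - w‖ := by
  have h : ∃ v ∈ K, ∀ w ∈ K, ‖u - v‖ ≤ ‖u - w‖ := by
    obtain ⟨v, hv, hmin⟩ := hK.exists_isMinOn (f := fun w => ‖u - w‖) hne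
      (by fun_prop)
    exact ⟨v, hv, fun w hw => hmin hw⟩
  rw [metricProj, dif_pos h]
  exact h.choose_spec

lemma inner_sub_metricProj_nonpos {k : ℕ} {K : Set (Vec k)} (hne : K.Nonempty)
    (hK : IsCompact K) (hc : Convex ℝ K) (u : Vec k) {w : Vec k} (hw : w ∈ K) :
    inner ℝ (u - metricProj K u) (w - metricProj K u) ≤ 0 := by
  obtain ⟨hmem, hmin⟩ := metricProj_spec hne hK u
  refine (norm_eq_iInf_iff_real_inner_le_zero hc hmem).1 ?_ w hw
  have : Nonempty K := ⟨⟨_, hmem⟩⟩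
  refine le_antisymm (le_ciInf fun w => hmin w w.2) ?_
  exact ciInf_le (f := fun w : K => ‖u - w‖)
    ⟨0, by rintro _ ⟨y, rfl⟩; exact norm_nonneg _⟩ ⟨_, hmem⟩

lemma norm_metricProj_sub_le {k : ℕ} {K : Set (Vec k)} (hne : K.Nonempty)
    (hK : IsCompact K) (hc : Convex ℝ K) (u v : Vec k) :
    ‖metricProj K u - metricProj K v‖ ≤ ‖u - v‖ := by
  have h1 := inner_sub_metricProj_nonpos hne hK hc u (metricProj_spec hne hK v).1
  have h2 := inner_sub_metricProj_nonpos hne hK hc v (metricProj_spec hne hK u).1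
  set a := metricProj K u
  set b := metricProj K v
  have h3 : ‖a - b‖ ^ 2 ≤ inner ℝ (u - v) (a - b) := by
    have : inner ℝ (u - v) (a - b) - ‖a - b‖ ^ 2
        = -(inner ℝ (u - a) (b - a)) - inner ℝ (v - b) (a - b) := by
      rw [← real_inner_self_eq_norm_sq]
      simp only [inner_sub_left, inner_sub_right]
      ring
    linarith
  have h4 := real_inner_le_norm (u - v) (a - b)
  by_contra! h
  nlinarith [norm_nonneg (a - b), norm_nonneg (u - v)]

lemma metricProj_eq_self {k : ℕ} {K : Set (Vec k)} (hK : IsCompact K) {w : Vec k} (hw : w ∈ K) :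
    metricProj K w = w := by
  have := (metricProj_spec ⟨w, hw⟩ hK w).2 w hw
  rw [sub_self, norm_zero, norm_le_zero_iff, sub_eq_zero] at this
  exact this.symm

lemma norm_metricProj_sub_le_of_mem {k : ℕ} {K : Set (Vec k)}
    (hK : IsCompact K) (hc : Convex ℝ K) (u : Vec k) {w : Vec k} (hw : w ∈ K) :
    ‖metricProj K u - w‖ ≤ ‖u - w‖ := by
  have := norm_metricProj_sub_le ⟨w, hw⟩ hK hc u w
  rwa [metricProj_eq_self hK hw] at this

lemma norm_posPartVec_sub_le {k : ℕ} (u : Vec k) {v : Vec k} (hv : v ∈ orthant k) :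
    ‖posPartVec u - v‖ ≤ ‖u - v‖ := by
  rw [EuclideanSpace.norm_eq, EuclideanSpace.norm_eq]
  refine Real.sqrt_le_sqrt (Finset.sum_le_sum fun j _ => ?_)
  simp only [posPartVec, PiLp.sub_apply, Real.norm_eq_abs, sq_abs]
  have := hv j
  rcases le_total (u j) 0 with h | h
  · rw [max_eq_right h]; nlinarith
  · rw [max_eq_left h]

lemma posPartVec_mem_orthant {k : ℕ} (u : Vec k) : posPartVec u ∈ orthant k :=
  fun j => le_max_right (u j) 0

lemma norm_posPartVec_le {k : ℕ} (u : Vec k) : ‖posPartVec u‖ ≤ ‖u‖ := by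
  simpa using norm_posPartVec_sub_le u (v := 0) (fun j => by simp)

lemma sum_smul_mem_orthant {N k : ℕ} {a : Fin N → ℝ} (ha : ∀ j, 0 ≤ a j) {u : Fin N → Vec k}
    (hu : ∀ j, u j ∈ orthant k) : ∑ j, a j • u j ∈ orthant k := fun l => by
  simpa using Finset.sum_nonneg fun j _ => mul_nonneg (ha j) (hu j l)

lemma smul_mem_orthant {k : ℕ} {a : ℝ} (ha : 0 ≤ a) {u : Vec k}
    (hu : u ∈ orthant k) : a • u ∈ orthant k := fun l => by
  simpa using mul_nonneg ha (hu l)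

lemma inner_eq_sum_mul {k : ℕ} (u v : Vec k) : inner ℝ u v = ∑ j, u j * v j := by
  simp [PiLp.inner_apply, mul_comm]

lemma inner_nonpos_of_orthant {k : ℕ} {u v : Vec k} (hu : u ∈ orthant k) (hv : ∀ j, v j ≤ 0) :
    inner ℝ u v ≤ 0 := by
  rw [inner_eq_sum_mul]
  exact Finset.sum_nonpos fun j _ => mul_nonpos_of_nonneg_of_nonpos (hu j) (hv j)

/-- Restricting to the segment from `x` to `y` reduces this to the slope inequality for a convex
function of one variable on [0, 1]. -/
lemma ConvexOn.hasFDerivAt_le_sub {E : Type*} [NormedAddCommGroup E] [NormedSpace ℝ E]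
    {K : Set E} {φ : E → ℝ} (hφ : ConvexOn ℝ K φ) {x y : E} (hx : x ∈ K) (hy : y ∈ K)
    {φ' : E →L[ℝ] ℝ} (h : HasFDerivAt φ φ' x) : φ' (y - x) ≤ φ y - φ x := by
  have hconv : ConvexOn ℝ (Set.Icc (0 : ℝ) 1) (φ ∘ AffineMap.lineMap x y) :=
    (hφ.comp_affineMap (AffineMap.lineMap x y)).subset
      (fun s hs => hφ.1.lineMap_mem hx hy hs) (convex_Icc 0 1)
  have hder : HasDerivAt (φ ∘ AffineMap.lineMap (k := ℝ) x y) (φ' (y - x)) 0 := by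
    refine HasFDerivAt.comp_hasDerivAt (0 : ℝ) ?_ AffineMap.hasDerivAt_lineMap
    simpa using h
  have := hconv.le_slope_of_hasDerivAt (Set.left_mem_Icc.2 zero_le_one)
    (Set.right_mem_Icc.2 zero_le_one) zero_lt_one hder
  simpa [slope_def_field] using this

lemma inner_gradMul_le {a b : ℕ} {φ : Vec a → Vec b} {K : Set (Vec a)}
    (hφ : ∀ j, ConvexOn ℝ K fun u => φ u j) {x y : Vec a} (hx : x ∈ K) (hy : y ∈ K)
    (hd : DifferentiableAt ℝ φ x) {v : Vec b} (hv : v ∈ orthant b) :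
    inner ℝ (gradMul φ x v) (y - x) ≤ inner ℝ v (φ y - φ x) := by
  rw [gradMul, ContinuousLinearMap.adjoint_inner_left, inner_eq_sum_mul, inner_eq_sum_mul]
  refine Finset.sum_le_sum fun j _ => mul_le_mul_of_nonneg_left ?_ (hv j)
  have h : HasFDerivAt (fun u => φ u j)
      ((EuclideanSpace.proj j : Vec b →L[ℝ] ℝ).comp (fderiv ℝ φ x)) x :=
    (EuclideanSpace.proj j : Vec b →L[ℝ] ℝ).hasFDerivAt.comp x hd.hasFDerivAt
  simpa using (hφ j).hasFDerivAt_le_sub hx hy h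

lemma norm_gradMul_le {a b : ℕ} {φ : Vec a → Vec b} {x : Vec a} {M : ℝ}
    (h : ‖fderiv ℝ φ x‖ ≤ M) (v : Vec b) : ‖gradMul φ x v‖ ≤ M * ‖v‖ := by
  refine (ContinuousLinearMap.le_opNorm _ _).trans ?_
  rw [LinearIsometryEquiv.norm_map]
  exact mul_le_mul_of_nonneg_right h (norm_nonneg _)

end Convexity

/-! ### Step sizes and summation by parts. -/

section StepSizes

/-- Step sizes that decay slowly: `1 / b` grows at step `t + 1` by at most `(b (t + 1)) ^ 3`. -/
structure IsSlowStep (b : ℕ → ℝ) : Prop where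
  zero : b 0 = 1
  pos : ∀ t, 0 < b t
  anti : Antitone b
  inv_sub_le : ∀ t, (b (t + 1))⁻¹ - (b t)⁻¹ ≤ b (t + 1) ^ 3

namespace IsSlowStep

variable {b : ℕ → ℝ} (hb : IsSlowStep b)
include hb

lemma le_one (t : ℕ) : b t ≤ 1 := hb.zero ▸ hb.anti (Nat.zero_le t)

/-- Controls the growth of 1/α_t. In r³ − s³ = (r − s)(r² + rs + s²) the first factor is at most b³
and the second at most 3b⁻², with b = `b (t + 1)`. -/
lemma inv_pow_three_sub_le (t : ℕ) :
    (b (t + 1) ^ 3)⁻¹ - (b t ^ 3)⁻¹ ≤ 3 * b (t + 1) := by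
  have h := hb.inv_sub_le t
  have hp := hb.pos (t + 1)
  rw [← inv_pow, ← inv_pow]
  have hs0 : 0 < (b t)⁻¹ := inv_pos.2 (hb.pos t)
  have hsr : (b t)⁻¹ ≤ (b (t + 1))⁻¹ := inv_anti₀ hp (hb.anti (Nat.le_succ t))
  have hrb : (b (t + 1))⁻¹ * b (t + 1) = 1 := inv_mul_cancel₀ hp.ne'
  set r := (b (t + 1))⁻¹
  set s := (b t)⁻¹
  set c := b (t + 1)
  calc r ^ 3 - s ^ 3 = (r - s) * (r ^ 2 + r * s + s ^ 2) := by ring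
    _ ≤ (r - s) * (3 * r ^ 2) :=
      mul_le_mul_of_nonneg_left (by nlinarith) (sub_nonneg.2 hsr)
    _ ≤ c ^ 3 * (3 * r ^ 2) := mul_le_mul_of_nonneg_right h (by positivity)
    _ = 3 * c * (r * c) ^ 2 := by ring
    _ = 3 * c := by rw [hrb]; ring

end IsSlowStep

/-- Abel summation: the increments of the weights are paired with `V (t + 1)`. The boundary term `w
T * V (T + 1)` is carried through the induction and dropped at the end. -/
lemma sum_sub_mul_le_of_increments {V w c : ℕ → ℝ} (hV : ∀ t, 0 ≤ V t)
    (hw : ∀ t, 0 ≤ w t) (h0 : V 0 * w 0 ≤ c 0)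
    (h : ∀ t, V (t + 1) * (w (t + 1) - w t) ≤ c (t + 1)) (T : ℕ) :
    ∑ t ∈ Finset.range (T + 1), (V t - V (t + 1)) * w t ≤ ∑ t ∈ Finset.range (T + 1), c t := by
  have key : ∑ t ∈ Finset.range (T + 1), (V t - V (t + 1)) * w t + w T * V (T + 1)
      ≤ ∑ t ∈ Finset.range (T + 1), c t := by
    induction T with
    | zero => simp only [zero_add, Finset.sum_range_one]; linarith
    | succ T ih =>
      rw [Finset.sum_range_succ, Finset.sum_range_succ _ (T + 1)]
      have := h T
      linarith
  have := mul_nonneg (hw T) (hV (T + 1))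
  linarith

lemma polyStep_pos (a : ℝ) (t : ℕ) : 0 < polyStep a t := by
  unfold polyStep
  split_ifs with h
  · exact one_pos
  · have : (0 : ℝ) < t := by exact_mod_cast Nat.pos_of_ne_zero h
    positivity

lemma polyStep_three_quarters (t : ℕ) : polyStep (3 / 4) t = polyStep (1 / 4) t ^ 3 := by
  unfold polyStep
  split_ifs with h
  · simp
  · rw [div_pow, one_pow, ← Real.rpow_natCast, ← Real.rpow_mul (Nat.cast_nonneg t)]
    norm_num

lemma fourth_roots_sub_le {r s : ℝ} (hs : 0 ≤ s) (hr : 0 < r) (h : r ^ 4 = s ^ 4 + 1) :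
    r - s ≤ r⁻¹ ^ 3 := by
  rw [inv_pow, ← one_div, le_div_iff₀ (by positivity)]
  have hsr : s ≤ r := by
    by_contra! hlt
    have := pow_lt_pow_left₀ hlt hr.le (n := 4) (by norm_num)
    linarith
  have : (r - s) * (r ^ 3 + r ^ 2 * s + r * s ^ 2 + s ^ 3) = 1 := by linear_combination h
  have h2 : 0 ≤ (r - s) * (r ^ 2 * s + r * s ^ 2 + s ^ 3) :=
    mul_nonneg (sub_nonneg.2 hsr) (by positivity)
  linarith

/-- Discrete form of ∫ t^{-1/4} dt = O(t^{3/4}). With 1 = r⁴ − s⁴ it becomes 0 ≤ r⁴ + s⁴ − 2rs³ =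
(r² − s²)² + 2rs²(r − s). -/
lemma fourth_roots_inv_le {r s : ℝ} (hr : 0 < r) (h : r ^ 4 = s ^ 4 + 1) (hs : s ≤ r) :
    r⁻¹ ≤ 2 * (r ^ 3 - s ^ 3) := by
  rw [← one_div, div_le_iff₀ hr]
  have h3 : 0 ≤ s ^ 2 * r * (r - s) := mul_nonneg (by positivity) (sub_nonneg.2 hs)
  nlinarith [sq_nonneg (r ^ 2 - s ^ 2)]

lemma rpow_quarter_pow_four (t : ℕ) : ((t : ℝ) ^ (1 / 4 : ℝ)) ^ 4 = t := by
  rw [← Real.rpow_natCast, ← Real.rpow_mul (Nat.cast_nonneg t)]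
  norm_num

lemma polyStep_succ (a : ℝ) (t : ℕ) : polyStep a (t + 1) = (((t + 1 : ℕ) : ℝ) ^ a)⁻¹ := by
  simp [polyStep]

lemma isSlowStep_polyStep : IsSlowStep (polyStep (1 / 4)) where
  zero := by simp [polyStep]
  pos := polyStep_pos _
  anti := by
    refine antitone_nat_of_succ_le fun t => ?_
    rcases Nat.eq_zero_or_pos t with rfl | ht
    · simp [polyStep]
    · obtain ⟨s, rfl⟩ := Nat.exists_eq_add_of_le' ht
      rw [polyStep_succ, polyStep_succ]
      refine inv_anti₀ (by positivity) (Real.rpow_le_rpow (by positivity) ?_ (by norm_num))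
      push_cast
      linarith
  inv_sub_le := fun t => by
    rcases Nat.eq_zero_or_pos t with rfl | ht
    · simp [polyStep]
    · obtain ⟨s, rfl⟩ := Nat.exists_eq_add_of_le' ht
      rw [polyStep_succ, polyStep_succ, inv_inv, inv_inv]
      refine fourth_roots_sub_le (by positivity) (by positivity) ?_
      rw [rpow_quarter_pow_four, rpow_quarter_pow_four]
      push_cast
      ring

lemma sum_polyStep_le (T : ℕ) :
    ∑ t ∈ Finset.range (T + 1), polyStep (1 / 4) t ≤ 1 + 2 * ((T : ℝ) ^ (1 / 4 : ℝ)) ^ 3 := by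
  induction T with
  | zero => simp [polyStep]
  | succ T ih =>
    rw [Finset.sum_range_succ, polyStep_succ]
    have := fourth_roots_inv_le (r := ((T + 1 : ℕ) : ℝ) ^ (1 / 4 : ℝ))
      (s := (T : ℝ) ^ (1 / 4 : ℝ)) (by positivity)
      (by rw [rpow_quarter_pow_four, rpow_quarter_pow_four]; push_cast; ring)
      (Real.rpow_le_rpow (by positivity) (by push_cast; linarith) (by norm_num))
    linarith

end StepSizes

/-! ### Deterministic estimates along one run. -/

section Run

variable {N n m : ℕ} {d : Fin N → ℕ}

/-- The ratio `(∑ⱼ A_{ij} u_j) / z'_i` of the push-sum protocol. -/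
noncomputable def pushSum {E : Type*} [AddCommGroup E] [Module ℝ E] (A : Matrix (Fin N) (Fin N) ℝ)
    (z' : Fin N → ℝ) (u : Fin N → E) (i : Fin N) : E :=
  (z' i)⁻¹ • ∑ j, A i j • u j

/-- A run of the primal-dual iteration along a given sequence `q` of gradient estimates, with step
sizes `b ^ 3`, `b`, `b`. -/
structure IsPrimalDualRun (Γ : AggGame N n m d) (W : ℕ → Matrix (Fin N) (Fin N) ℝ) (b : ℕ → ℝ)
    (q : ℕ → Joint d) (st : ℕ → PDState n m d) : Prop where
  z_zero : ∀ i, (st 0).z i = 1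
  mu_zero : ∀ i, (st 0).mu i = 0
  sig_zero : ∀ i, (st 0).sig i = Γ.ψ i ((st 0).x i)
  x_mem : ∀ t i, (st t).x i ∈ Γ.X i
  z_succ : ∀ t i, (st (t + 1)).z i = ∑ j, W t i j * (st t).z j
  x_succ : ∀ t i, (st (t + 1)).x i = metricProj (Γ.X i) ((st t).x i - b t ^ 3 •
    (q t i + gradMul (Γ.g i) ((st t).x i) (pushSum (W t) (st (t + 1)).z (st t).mu i)))
  mu_succ : ∀ t i, (st (t + 1)).mu i = posPartVec ((∑ j, W t i j • (st t).mu j)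
    + b t • (Γ.g i ((st t).x i) - b t • ∑ j, W t i j • (st t).mu j))
  sig_succ : ∀ t i, (st (t + 1)).sig i
    = (∑ j, W t i j • (st t).sig j) + Γ.ψ i ((st (t + 1)).x i) - Γ.ψ i ((st t).x i)

/-- A common bound on the constraint functions and their derivatives, the contributions to the
aggregate, and the diameters of the local sets. -/
structure AggGame.BoundedBy (Γ : AggGame N n m d) (B : ℝ) : Prop where
  nonneg : 0 ≤ B
  g_le : ∀ i, ∀ x ∈ Γ.X i, ‖Γ.g i x‖ ≤ B
  ψ_le : ∀ i, ∀ x ∈ Γ.X i, ‖Γ.ψ i x‖ ≤ B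
  grad_g_le : ∀ i, ∀ x ∈ Γ.X i, ‖fderiv ℝ (Γ.g i) x‖ ≤ B
  diam_le : ∀ i, ∀ x ∈ Γ.X i, ∀ x' ∈ Γ.X i, ‖x - x'‖ ≤ B

lemma AggGame.Regular.exists_boundedBy {Γ : AggGame N n m d} (hΓ : Γ.Regular) :
    ∃ B, Γ.BoundedBy B := by
  have hg : ∀ i, ∃ C, ∀ x ∈ Γ.X i, ‖Γ.g i x‖ ≤ C := fun i =>
    (hΓ.compact i).exists_bound_of_continuousOn fun x hx =>
      (hΓ.diff_g i x hx).continuousAt.continuousWithinAt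
  have hψ : ∀ i, ∃ C, ∀ x ∈ Γ.X i, ‖Γ.ψ i x‖ ≤ C := fun i =>
    (hΓ.compact i).exists_bound_of_continuousOn fun x hx =>
      (hΓ.diff_ψ i x hx).continuousAt.continuousWithinAt
  have hX : ∀ i, ∃ C, ∀ x ∈ Γ.X i, ‖x‖ ≤ C := fun i =>
    (hΓ.compact i).exists_bound_of_continuousOn continuousOn_id
  choose Cg hCg using hg
  choose Cψ hCψ using hψ
  choose CX hCX using hX
  obtain ⟨M, hM⟩ := hΓ.bdd_grad_g
  have hle : ∀ (c : Fin N → ℝ) i, c i ≤ ∑ i, |c i| := fun c i =>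
    (le_abs_self _).trans (Finset.single_le_sum (f := fun i => |c i|)
      (fun i _ => abs_nonneg _) (Finset.mem_univ i))
  have h0 : ∀ c : Fin N → ℝ, 0 ≤ ∑ i, |c i| := fun c => Finset.sum_nonneg fun i _ => abs_nonneg _
  have h1 := h0 Cg
  have h2 := h0 Cψ
  have h3 := h0 CX
  have h4 := abs_nonneg M
  refine ⟨∑ i, |Cg i| + ∑ i, |Cψ i| + 2 * ∑ i, |CX i| + |M|, by positivity, fun i x hx => ?_,
    fun i x hx => ?_, fun i x hx => ?_, fun i x hx x' hx' => ?_⟩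
  · linarith [hCg i x hx, hle Cg i]
  · linarith [hCψ i x hx, hle Cψ i]
  · linarith [hM i x hx, le_abs_self M]
  · linarith [norm_sub_le x x', hCX i x hx, hCX i x' hx', hle CX i]

/-- Joint convexity of ‖u‖²/z, in the form of Cauchy–Schwarz. It is why the dual potential is
weighted by 1/z: column stochasticity alone then makes mixing nonexpansive. -/
lemma sum_norm_sq_div_le {E : Type*} [NormedAddCommGroup E] [NormedSpace ℝ E]
    {A : Matrix (Fin N) (Fin N) ℝ} (hA : ∀ i j, 0 ≤ A i j) (hc : ∀ j, ∑ i, A i j = 1)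
    {z : Fin N → ℝ} (hz : ∀ j, 0 < z j) (hz' : ∀ i, 0 < ∑ j, A i j * z j) (u : Fin N → E) :
    ∑ i, ‖∑ j, A i j • u j‖ ^ 2 / (∑ j, A i j * z j) ≤ ∑ j, ‖u j‖ ^ 2 / z j := by
  calc _ ≤ ∑ i, ∑ j, A i j * (‖u j‖ ^ 2 / z j) := by
        refine Finset.sum_le_sum fun i _ => ?_
        rw [div_le_iff₀ (hz' i)]
        have h1 : ‖∑ j, A i j • u j‖ ≤ ∑ j, A i j * ‖u j‖ :=
          (norm_sum_le _ _).trans_eq (Finset.sum_congr rfl fun j _ => by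
            rw [norm_smul, Real.norm_of_nonneg (hA i j)])
        refine (pow_le_pow_left₀ (norm_nonneg _) h1 2).trans ?_
        refine Finset.sum_sq_le_sum_mul_sum_of_sq_le_mul _
          (fun j _ => mul_nonneg (hA i j) (div_nonneg (sq_nonneg _) (hz j).le))
          (fun j _ => mul_nonneg (hA i j) (hz j).le) fun j _ => le_of_eq ?_
        have := (hz j).ne'
        field_simp
    _ = _ := by
        rw [Finset.sum_comm]
        simp only [← Finset.sum_mul, hc, one_mul]

/-- The multiplier is z·v, so the step is compared with z·l. The regularisation contributes −2c²z⟨v,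
v − l⟩ after division by z, which is at most c²z‖l‖² whatever v is; hence no bound on v enters
except through `G`. -/
lemma dual_step_le {k : ℕ} {z c G M : ℝ} (hz : 0 < z) (hzM : z ≤ M)
    (v g : Vec k) {l : Vec k} (hl : l ∈ orthant k) (hG : ‖g - c • z • v‖ ≤ G) :
    ‖posPartVec (z • v + c • (g - c • z • v)) - z • l‖ ^ 2 / z
      ≤ ‖z • v - z • l‖ ^ 2 / z + 2 * c * inner ℝ g (v - l)
        + c ^ 2 * (M * ‖l‖ ^ 2 + G ^ 2 / z) := by
  have h1 := norm_posPartVec_sub_le (z • v + c • (g - c • z • v)) (smul_mem_orthant hz.le hl)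
  have h2 : ‖z • v + c • (g - c • z • v) - z • l‖ ^ 2
      = ‖z • v - z • l‖ ^ 2 + 2 * c * z * (inner ℝ g (v - l) - c * z * inner ℝ v (v - l))
        + c ^ 2 * ‖g - c • z • v‖ ^ 2 := by
    rw [show z • v + c • (g - c • z • v) - z • l = (z • v - z • l) + c • (g - c • z • v) by abel,
      norm_add_sq_real, norm_smul, mul_pow, Real.norm_eq_abs, sq_abs, ← smul_sub]
    simp only [real_inner_smul_left, real_inner_smul_right, inner_sub_right, inner_sub_left]
    rw [real_inner_comm v g, real_inner_comm l g, real_inner_comm l v]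
    ring
  have h3 : -inner ℝ v (v - l) ≤ ‖l‖ ^ 2 / 2 := by
    rw [inner_sub_right, real_inner_self_eq_norm_sq]
    have := norm_sub_sq_real v l
    nlinarith [sq_nonneg ‖v - l‖, sq_nonneg ‖v‖]
  have h4 : ‖g - c • z • v‖ ^ 2 ≤ G ^ 2 := pow_le_pow_left₀ (norm_nonneg _) hG 2
  have h5 := pow_le_pow_left₀ (norm_nonneg _) h1 2
  rw [h2] at h5
  calc _ ≤ (‖z • v - z • l‖ ^ 2 + 2 * c * z * (inner ℝ g (v - l) - c * z * inner ℝ v (v - l))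
        + c ^ 2 * G ^ 2) / z := by
        refine div_le_div_of_nonneg_right (h5.trans ?_) hz.le
        have := mul_le_mul_of_nonneg_left h4 (sq_nonneg c)
        linarith
    _ = ‖z • v - z • l‖ ^ 2 / z + 2 * c * inner ℝ g (v - l)
        + c ^ 2 * (z * 2 * -inner ℝ v (v - l) + G ^ 2 / z) := by
        field_simp
        ring
    _ ≤ _ := by
        have h6 : z * 2 * -inner ℝ v (v - l) ≤ M * ‖l‖ ^ 2 := by
          calc z * 2 * -inner ℝ v (v - l) ≤ z * 2 * (‖l‖ ^ 2 / 2) :=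
                mul_le_mul_of_nonneg_left h3 (by positivity)
            _ = z * ‖l‖ ^ 2 := by ring
            _ ≤ M * ‖l‖ ^ 2 := mul_le_mul_of_nonneg_right hzM (sq_nonneg _)
        exact add_le_add le_rfl (mul_le_mul_of_nonneg_left (add_le_add h6 le_rfl) (sq_nonneg c))

lemma primal_step_le {k : ℕ} {K : Set (Vec k)} (hK : IsCompact K) (hc : Convex ℝ K)
    {x y : Vec k} (hy : y ∈ K) (s : Vec k) {a : ℝ} (ha : 0 < a) :
    inner ℝ s (x - y) ≤ (‖x - y‖ ^ 2 - ‖metricProj K (x - a • s) - y‖ ^ 2) * a⁻¹ / 2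
      + a / 2 * ‖s‖ ^ 2 := by
  have h1 := pow_le_pow_left₀ (norm_nonneg _) (norm_metricProj_sub_le_of_mem hK hc (x - a • s) hy) 2
  have h2 : ‖x - a • s - y‖ ^ 2 = ‖x - y‖ ^ 2 - 2 * a * inner ℝ s (x - y) + a ^ 2 * ‖s‖ ^ 2 := by
    rw [show x - a • s - y = (x - y) - a • s by abel, norm_sub_sq_real, norm_smul, mul_pow,
      Real.norm_eq_abs, sq_abs, real_inner_smul_right, real_inner_comm]
    ring
  rw [h2] at h1
  have h3 : inner ℝ s (x - y) = (‖x - y‖ ^ 2 - (‖x - y‖ ^ 2 - 2 * a * inner ℝ s (x - y)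
      + a ^ 2 * ‖s‖ ^ 2)) * a⁻¹ / 2 + a / 2 * ‖s‖ ^ 2 := by
    field_simp
    ring
  rw [h3]
  gcongr

/-- The variational inequality at a point that satisfies the KKT conditions. -/
lemma AggGame.IsKKT.inner_G_ge {Γ : AggGame N n m d} (hΓ : Γ.Regular) {xs : Joint d} {lam : Vec m}
    (hfeas : xs ∈ Γ.feasible) (h : Γ.IsKKT xs lam) {x : Joint d} (hx : ∀ i, x i ∈ Γ.X i) :
    -inner ℝ lam (Γ.coupled x) ≤ ∑ i, inner ℝ (Γ.G xs i) (x i - xs i) := by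
  obtain ⟨h1, hlam, h2⟩ := h
  -- Complementarity, tested against the zero multiplier.
  have h3 : 0 ≤ inner ℝ lam (Γ.coupled xs) := by
    have := h2 0 (fun j => by simp)
    rw [zero_sub, inner_neg_right, real_inner_comm] at this
    linarith
  have h4 : ∀ i, -inner ℝ lam (Γ.g i (x i) - Γ.g i (xs i)) ≤ inner ℝ (Γ.G xs i) (x i - xs i) := by
    intro i
    have h5 := (h1 i).2 (x i) (hx i)
    rw [inner_neg_left, inner_add_left] at h5
    have h6 := inner_gradMul_le (hΓ.convex_g i) (hfeas.1 i) (hx i)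
      (hΓ.diff_g i _ (hfeas.1 i)) hlam
    simp only [AggGame.G]
    linarith
  have h7 := Finset.sum_le_sum fun i (_ : i ∈ Finset.univ) => h4 i
  simp only [Finset.sum_neg_distrib, ← inner_sum, Finset.sum_sub_distrib, inner_sub_right] at h7
  simp only [AggGame.coupled] at h3 ⊢
  simp only [inner_sub_right, Finset.sum_sub_distrib]
  linarith

namespace IsPrimalDualRun

variable {Γ : AggGame N n m d} {W : ℕ → Matrix (Fin N) (Fin N) ℝ} {b : ℕ → ℝ}
  {q : ℕ → Joint d} {st : ℕ → PDState n m d} {B zmin S : ℝ}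

lemma mu_mem_orthant (h : IsPrimalDualRun Γ W b q st) (t : ℕ) (i : Fin N) :
    (st t).mu i ∈ orthant m := by
  cases t with
  | zero => rw [h.mu_zero]; exact fun j => by simp
  | succ t => rw [h.mu_succ]; exact posPartVec_mem_orthant _

/-- The total size M of the multipliers satisfies M' ≤ (1 − b²)M + bNB, whose fixed point is NB/b.
This level only rises as `b` decreases, so it is never exceeded. -/
lemma sum_norm_mu_le (h : IsPrimalDualRun Γ W b q st) (hb : IsSlowStep b)
    (hW : GraphAssumption W) (hB : Γ.BoundedBy B) (t : ℕ) :
    ∑ i, ‖(st t).mu i‖ ≤ N * B / b t := by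
  induction t with
  | zero =>
    simp only [h.mu_zero, norm_zero, Finset.sum_const_zero]
    exact div_nonneg (mul_nonneg (Nat.cast_nonneg _) hB.nonneg) (hb.pos 0).le
  | succ t ih =>
    have hp := hb.pos t
    have h1 := hb.le_one t
    have hb2 : 0 ≤ 1 - b t ^ 2 := by nlinarith
    have hi : ∀ i, ‖(st (t + 1)).mu i‖
        ≤ (1 - b t ^ 2) * ‖∑ j, W t i j • (st t).mu j‖ + b t * B := by
      intro i
      rw [h.mu_succ]
      refine (norm_posPartVec_le _).trans ?_
      have : (∑ j, W t i j • (st t).mu j)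
          + b t • (Γ.g i ((st t).x i) - b t • ∑ j, W t i j • (st t).mu j)
          = (1 - b t ^ 2) • (∑ j, W t i j • (st t).mu j) + b t • Γ.g i ((st t).x i) := by
        module
      rw [this]
      refine (norm_add_le _ _).trans ?_
      rw [norm_smul, norm_smul, Real.norm_of_nonneg hb2, Real.norm_of_nonneg hp.le]
      gcongr
      exact hB.g_le i _ (h.x_mem t i)
    have hsum := sum_norm_sum_smul_le (hW.nonneg t) (hW.column_stochastic t) (st t).mu
    rw [one_mul] at hsum
    calc ∑ i, ‖(st (t + 1)).mu i‖
        ≤ ∑ i, ((1 - b t ^ 2) * ‖∑ j, W t i j • (st t).mu j‖ + b t * B) :=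
          Finset.sum_le_sum fun i _ => hi i
      _ = (1 - b t ^ 2) * ∑ i, ‖∑ j, W t i j • (st t).mu j‖ + b t * (N * B) := by
          rw [Finset.sum_add_distrib, ← Finset.mul_sum]
          simp
          ring
      _ ≤ (1 - b t ^ 2) * (N * B / b t) + b t * (N * B) := by
          gcongr
          exact hsum.trans ih
      _ = N * B / b t := by field_simp; ring
      _ ≤ N * B / b (t + 1) := div_le_div_of_nonneg_left
          (mul_nonneg (Nat.cast_nonneg _) hB.nonneg) (hb.pos _) (hb.anti (Nat.le_succ t))

lemma norm_mu_le (h : IsPrimalDualRun Γ W b q st) (hb : IsSlowStep b)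
    (hW : GraphAssumption W) (hB : Γ.BoundedBy B) (t : ℕ) (i : Fin N) :
    ‖(st t).mu i‖ ≤ N * B / b t :=
  (Finset.single_le_sum (f := fun j => ‖(st t).mu j‖) (fun _ _ => norm_nonneg _)
    (Finset.mem_univ i)).trans (h.sum_norm_mu_le hb hW hB t)

lemma norm_muHat_le (h : IsPrimalDualRun Γ W b q st) (hb : IsSlowStep b)
    (hW : GraphAssumption W) (hB : Γ.BoundedBy B) (t : ℕ) (i : Fin N) :
    ‖∑ j, W t i j • (st t).mu j‖ ≤ N * B / b t := by
  have hsum := sum_norm_sum_smul_le (hW.nonneg t) (hW.column_stochastic t) (st t).mu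
  rw [one_mul] at hsum
  exact (Finset.single_le_sum (f := fun i => ‖∑ j, W t i j • (st t).mu j‖)
    (fun i _ => norm_nonneg _) (Finset.mem_univ i)).trans
      (hsum.trans (h.sum_norm_mu_le hb hW hB t))

lemma norm_dual_direction_le (h : IsPrimalDualRun Γ W b q st) (hb : IsSlowStep b)
    (hW : GraphAssumption W) (hB : Γ.BoundedBy B) (t : ℕ) (i : Fin N) :
    ‖Γ.g i ((st t).x i) - b t • ∑ j, W t i j • (st t).mu j‖ ≤ (N + 1) * B := by
  refine (norm_sub_le _ _).trans ?_
  rw [norm_smul, Real.norm_of_nonneg (hb.pos t).le]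
  have h1 := hB.g_le i _ (h.x_mem t i)
  have h2 := mul_le_mul_of_nonneg_left (h.norm_muHat_le hb hW hB t i) (hb.pos t).le
  rw [mul_div_cancel₀ _ (hb.pos t).ne'] at h2
  linarith

lemma norm_mu_succ_sub_le (h : IsPrimalDualRun Γ W b q st) (hb : IsSlowStep b)
    (hW : GraphAssumption W) (hB : Γ.BoundedBy B) (t : ℕ) (i : Fin N) :
    ‖(st (t + 1)).mu i - ∑ j, W t i j • (st t).mu j‖ ≤ (N + 1) * B * b t := by
  rw [h.mu_succ]
  refine (norm_posPartVec_sub_le _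
    (sum_smul_mem_orthant (hW.nonneg t i) (h.mu_mem_orthant t))).trans ?_
  rw [add_sub_cancel_left, norm_smul, Real.norm_of_nonneg (hb.pos t).le, mul_comm]
  exact mul_le_mul_of_nonneg_right (h.norm_dual_direction_le hb hW hB t i) (hb.pos t).le

lemma norm_pushSum_mu_le (h : IsPrimalDualRun Γ W b q st) (hb : IsSlowStep b)
    (hW : GraphAssumption W) (hB : Γ.BoundedBy B) (hzmin : 0 < zmin)
    (hz : ∀ t i, zmin ≤ (st t).z i) (t : ℕ) (i : Fin N) :
    ‖pushSum (W t) (st (t + 1)).z (st t).mu i‖ ≤ zmin⁻¹ * (N * B) / b t := by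
  have hp := hzmin.trans_le (hz (t + 1) i)
  rw [pushSum, norm_smul, Real.norm_of_nonneg (by positivity), mul_div_assoc]
  exact mul_le_mul (inv_anti₀ hzmin (hz _ _)) (h.norm_muHat_le hb hW hB t i) (norm_nonneg _)
    (by positivity)

/-- The primal update direction. -/
lemma norm_direction_le (h : IsPrimalDualRun Γ W b q st) (hb : IsSlowStep b)
    (hW : GraphAssumption W) (hB : Γ.BoundedBy B) (hzmin : 0 < zmin)
    (hz : ∀ t i, zmin ≤ (st t).z i) (hS : 0 ≤ S) (hq : ∀ t i, ‖q t i‖ ≤ S) (t : ℕ) (i : Fin N) :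
    ‖q t i + gradMul (Γ.g i) ((st t).x i) (pushSum (W t) (st (t + 1)).z (st t).mu i)‖
      ≤ (S + B * (zmin⁻¹ * (N * B))) / b t := by
  have hp := hb.pos t
  have h1 : S ≤ S / b t := by
    rw [le_div_iff₀ hp]
    nlinarith [hb.le_one t]
  have h2 := norm_gradMul_le (hB.grad_g_le i _ (h.x_mem t i))
    (pushSum (W t) (st (t + 1)).z (st t).mu i)
  have h3 := mul_le_mul_of_nonneg_left (h.norm_pushSum_mu_le hb hW hB hzmin hz t i) hB.nonneg
  have h4 := norm_add_le (q t i)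
    (gradMul (Γ.g i) ((st t).x i) (pushSum (W t) (st (t + 1)).z (st t).mu i))
  rw [add_div]
  rw [← mul_div_assoc] at h3
  linarith [hq t i]

/-- The primal variable moves by at most b³ · Cs/b = Cs·b² ≤ Cs·b. The cruder power is kept because
it matches the other error terms. -/
lemma norm_sig_succ_sub_le (h : IsPrimalDualRun Γ W b q st) (hΓ : Γ.Regular) (hb : IsSlowStep b)
    {Ls Cs : ℝ} (hLs : 0 ≤ Ls) (hCs : 0 ≤ Cs)
    (hψ : ∀ i, ∀ x ∈ Γ.X i, ∀ x' ∈ Γ.X i, ‖Γ.ψ i x - Γ.ψ i x'‖ ≤ Ls * ‖x - x'‖)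
    (hs : ∀ t i, ‖q t i + gradMul (Γ.g i) ((st t).x i)
      (pushSum (W t) (st (t + 1)).z (st t).mu i)‖ ≤ Cs / b t) (t : ℕ) (i : Fin N) :
    ‖(st (t + 1)).sig i - ∑ j, W t i j • (st t).sig j‖ ≤ Ls * Cs * b t := by
  have hp := hb.pos t
  rw [h.sig_succ, show ∀ a c e : Vec n, a + c - e - a = c - e by intros; abel]
  refine (hψ i _ (h.x_mem _ i) _ (h.x_mem _ i)).trans ?_
  rw [mul_assoc]
  refine mul_le_mul_of_nonneg_left ?_ hLs
  rw [h.x_succ]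
  refine (norm_metricProj_sub_le_of_mem (hΓ.compact i) (hΓ.convex i) _ (h.x_mem t i)).trans ?_
  rw [sub_sub_cancel_left, norm_neg, norm_smul, Real.norm_of_nonneg (by positivity)]
  calc b t ^ 3 * _ ≤ b t ^ 3 * (Cs / b t) := mul_le_mul_of_nonneg_left (hs t i) (by positivity)
    _ = Cs * b t * b t := by field_simp
    _ ≤ Cs * b t := mul_le_of_le_one_right (by positivity) (hb.le_one t)

/-- The tracking invariant: mixing preserves the sum and the corrections telescope, so the mean of
the trackers is the true aggregate. -/
lemma sum_sig_eq (h : IsPrimalDualRun Γ W b q st) (hW : GraphAssumption W) (t : ℕ) :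
    ∑ i, (st t).sig i = ∑ i, Γ.ψ i ((st t).x i) := by
  induction t with
  | zero => simp only [h.sig_zero]
  | succ t ih =>
    simp only [h.sig_succ, Finset.sum_sub_distrib, Finset.sum_add_distrib]
    rw [Finset.sum_comm]
    simp only [← Finset.sum_smul, hW.column_stochastic, one_smul, ih]
    abel

/-- The weighted squared distance of the multipliers to `lam`. -/
noncomputable def dualPotential (st : ℕ → PDState n m d) (lam : Vec m) (t : ℕ) : ℝ :=
  ∑ i, ‖(st t).mu i - (st t).z i • lam‖ ^ 2 / (st t).z i

/-- Mixing does not increase the potential (`sum_norm_sq_div_le`), and then `dual_step_le` is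
applied to each player, with `z ≤ N` because the weights sum to `N`. -/
lemma dualPotential_succ_le (h : IsPrimalDualRun Γ W b q st) (hb : IsSlowStep b)
    (hW : GraphAssumption W) (hB : Γ.BoundedBy B) (hzmin : 0 < zmin)
    (hz : ∀ t i, zmin ≤ (st t).z i) (hzN : ∀ t, ∑ i, (st t).z i = N) {lam : Vec m}
    (hlam : lam ∈ orthant m) (t : ℕ) :
    dualPotential st lam (t + 1) ≤ dualPotential st lam t
      + 2 * b t * ∑ i, inner ℝ (Γ.g i ((st t).x i))
          (pushSum (W t) (st (t + 1)).z (st t).mu i - lam)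
      + b t ^ 2 * (N * (N * ‖lam‖ ^ 2 + ((N + 1) * B) ^ 2 / zmin)) := by
  have hzpos : ∀ t i, 0 < (st t).z i := fun t i => hzmin.trans_le (hz t i)
  have hzle : ∀ i, (st (t + 1)).z i ≤ N := fun i => (hzN (t + 1)) ▸
    Finset.single_le_sum (fun i _ => (hzpos (t + 1) i).le) (Finset.mem_univ i)
  have hv : ∀ i, (st (t + 1)).z i • pushSum (W t) (st (t + 1)).z (st t).mu i
      = ∑ j, W t i j • (st t).mu j := fun i => by
    rw [pushSum, smul_smul, mul_inv_cancel₀ (hzpos _ _).ne', one_smul]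
  have hjensen : ∑ i, ‖(st (t + 1)).z i • pushSum (W t) (st (t + 1)).z (st t).mu i
      - (st (t + 1)).z i • lam‖ ^ 2 / (st (t + 1)).z i ≤ dualPotential st lam t := by
    have := sum_norm_sq_div_le (hW.nonneg t) (hW.column_stochastic t) (hzpos t)
      (fun i => by rw [← h.z_succ]; exact hzpos _ _)
      (fun j => (st t).mu j - (st t).z j • lam)
    refine le_trans (le_of_eq ?_) this
    refine Finset.sum_congr rfl fun i _ => ?_
    rw [hv, h.z_succ]
    simp only [smul_sub, Finset.sum_sub_distrib, Finset.sum_smul, smul_smul]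
  have hi : ∀ i, ‖(st (t + 1)).mu i - (st (t + 1)).z i • lam‖ ^ 2 / (st (t + 1)).z i
      ≤ ‖(st (t + 1)).z i • pushSum (W t) (st (t + 1)).z (st t).mu i
          - (st (t + 1)).z i • lam‖ ^ 2 / (st (t + 1)).z i
        + 2 * b t * inner ℝ (Γ.g i ((st t).x i))
          (pushSum (W t) (st (t + 1)).z (st t).mu i - lam)
        + b t ^ 2 * (N * ‖lam‖ ^ 2 + ((N + 1) * B) ^ 2 / zmin) := by
    intro i
    have h1 := dual_step_le (hzpos (t + 1) i) (hzle i)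
      (pushSum (W t) (st (t + 1)).z (st t).mu i) (Γ.g i ((st t).x i)) hlam
      (G := (N + 1) * B) (by rw [hv]; exact h.norm_dual_direction_le hb hW hB t i)
    rw [h.mu_succ, ← hv]
    refine h1.trans ?_
    have := hz (t + 1) i
    gcongr
  refine (Finset.sum_le_sum fun i _ => hi i).trans ?_
  simp only [Finset.sum_add_distrib, Finset.sum_const, Finset.card_univ, Fintype.card_fin,
    nsmul_eq_mul, ← Finset.mul_sum]
  have : (N : ℝ) * (b t ^ 2 * (N * ‖lam‖ ^ 2 + ((N + 1) * B) ^ 2 / zmin))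
    = b t ^ 2 * (N * (N * ‖lam‖ ^ 2 + ((N + 1) * B) ^ 2 / zmin)) := by ring
  linarith

lemma dualPotential_nonneg (hzmin : 0 < zmin) (hz : ∀ t i, zmin ≤ (st t).z i) (lam : Vec m)
    (t : ℕ) : 0 ≤ dualPotential st lam t :=
  Finset.sum_nonneg fun i _ => div_nonneg (sq_nonneg _) (hzmin.trans_le (hz t i)).le

lemma dualPotential_le (h : IsPrimalDualRun Γ W b q st) (hb : IsSlowStep b)
    (hW : GraphAssumption W) (hB : Γ.BoundedBy B) (hzmin : 0 < zmin)
    (hz : ∀ t i, zmin ≤ (st t).z i) (hzN : ∀ t, ∑ i, (st t).z i = N) (lam : Vec m) (t : ℕ) :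
    dualPotential st lam t ≤ N * (N * B + N * ‖lam‖) ^ 2 / zmin * (b t ^ 2)⁻¹ := by
  have hp := hb.pos t
  have hzpos : ∀ i, 0 < (st t).z i := fun i => hzmin.trans_le (hz t i)
  have hzle : ∀ i, (st t).z i ≤ N := fun i => (hzN t) ▸
    Finset.single_le_sum (fun i _ => (hzpos i).le) (Finset.mem_univ i)
  have hi : ∀ i, ‖(st t).mu i - (st t).z i • lam‖ ^ 2 / (st t).z i
      ≤ ((N * B + N * ‖lam‖) / b t) ^ 2 / zmin := by
    intro i
    have h1 : ‖(st t).mu i - (st t).z i • lam‖ ≤ (N * B + N * ‖lam‖) / b t := by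
      refine (norm_sub_le _ _).trans ?_
      rw [norm_smul, Real.norm_of_nonneg (hzpos i).le, add_div]
      refine add_le_add (h.norm_mu_le hb hW hB t i) ?_
      rw [le_div_iff₀ hp]
      calc (st t).z i * ‖lam‖ * b t ≤ (st t).z i * ‖lam‖ * 1 :=
            mul_le_mul_of_nonneg_left (hb.le_one t) (mul_nonneg (hzpos i).le (norm_nonneg _))
        _ ≤ _ := by rw [mul_one]; exact mul_le_mul_of_nonneg_right (hzle i) (norm_nonneg _)
    have := hz t i
    gcongr
  refine (Finset.sum_le_sum fun i _ => hi i).trans_eq ?_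
  simp only [Finset.sum_const, Finset.card_univ, Fintype.card_fin, nsmul_eq_mul]
  field_simp

end IsPrimalDualRun

end Run

/-! ### The regret inequality. -/

section Regret

variable {N n m : ℕ} {d : Fin N → ℕ}

namespace IsPrimalDualRun

variable {Γ : AggGame N n m d} {W : ℕ → Matrix (Fin N) (Fin N) ℝ} {b : ℕ → ℝ}
  {q : ℕ → Joint d} {st : ℕ → PDState n m d} {B zmin S : ℝ}

/-- The disagreement of the push-sum ratios of `u`. -/
noncomputable def disagreement {E : Type*} [NormedAddCommGroup E] [NormedSpace ℝ E]
    (W : ℕ → Matrix (Fin N) (Fin N) ℝ) (st : ℕ → PDState n m d) (u : ℕ → Fin N → E) (t : ℕ) : ℝ :=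
  ∑ i, ‖pushSum (W t) (st (t + 1)).z (u t) i - (1 / (N : ℝ)) • ∑ j, u t j‖

/-- The effect at time `t` of the errors of the gradient estimates. -/
noncomputable def gradientNoise (Γ : AggGame N n m d) (W : ℕ → Matrix (Fin N) (Fin N) ℝ)
    (q : ℕ → Joint d) (st : ℕ → PDState n m d) (xs : Joint d) (t : ℕ) : ℝ :=
  ∑ i, inner ℝ (q t i - Γ.p i ((st t).x i) (pushSum (W t) (st (t + 1)).z (st t).sig i))
    (xs i - (st t).x i)

/-- With the common mean multiplier in place of the individual ratios, the sum is ⟨mean, g(x*)⟩ ≤ 0,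
since the mean is nonnegative and x* feasible. Replacing it costs the disagreement. -/
lemma sum_inner_pushSum_g_le (h : IsPrimalDualRun Γ W b q st) (hB : Γ.BoundedBy B)
    {xs : Joint d} (hfeas : xs ∈ Γ.feasible) (t : ℕ) :
    ∑ i, inner ℝ (pushSum (W t) (st (t + 1)).z (st t).mu i) (Γ.g i (xs i))
      ≤ B * disagreement W st (fun t => (st t).mu) t := by
  have hmean : inner ℝ ((1 / (N : ℝ)) • ∑ j, (st t).mu j) (Γ.coupled xs) ≤ 0 := by
    refine inner_nonpos_of_orthant (smul_mem_orthant (by positivity) ?_) hfeas.2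
    simpa using sum_smul_mem_orthant (a := fun _ => 1) (fun _ => zero_le_one) (h.mu_mem_orthant t)
  calc _ ≤ ∑ i, (B * ‖pushSum (W t) (st (t + 1)).z (st t).mu i
            - (1 / (N : ℝ)) • ∑ j, (st t).mu j‖
          + inner ℝ ((1 / (N : ℝ)) • ∑ j, (st t).mu j) (Γ.g i (xs i))) := by
        refine Finset.sum_le_sum fun i _ => ?_
        have h1 := real_inner_le_norm (pushSum (W t) (st (t + 1)).z (st t).mu i
            - (1 / (N : ℝ)) • ∑ j, (st t).mu j) (Γ.g i (xs i))
        have h2 := mul_le_mul_of_nonneg_left (hB.g_le i _ (hfeas.1 i))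
          (norm_nonneg (pushSum (W t) (st (t + 1)).z (st t).mu i
            - (1 / (N : ℝ)) • ∑ j, (st t).mu j))
        rw [inner_sub_left] at h1
        linarith
    _ = B * disagreement W st (fun t => (st t).mu) t
        + inner ℝ ((1 / (N : ℝ)) • ∑ j, (st t).mu j) (Γ.coupled xs) := by
        rw [Finset.sum_add_distrib, ← Finset.mul_sum, ← inner_sum]
        rfl
    _ ≤ _ := by linarith

/-- The primal inequality leaves −∑⟨g_i(x_i), v_i⟩, the dual inequality bounds −∑⟨g_i(x_i), v_i −
λ⟩, and strong monotonicity with KKT needs ⟨λ, g(x)⟩. These combine with nothing left over. -/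
lemma regret_step (h : IsPrimalDualRun Γ W b q st) (hΓ : Γ.Regular) (hb : IsSlowStep b)
    (hW : GraphAssumption W) (hB : Γ.BoundedBy B) (hzmin : 0 < zmin)
    (hz : ∀ t i, zmin ≤ (st t).z i) (hzN : ∀ t, ∑ i, (st t).z i = N)
    {Lf Cs c : ℝ} (hLf : 0 ≤ Lf)
    (hp : ∀ i, ∀ x ∈ Γ.X i, ∀ y y' : Vec n, ‖Γ.p i x y - Γ.p i x y'‖ ≤ Lf * ‖y - y'‖)
    (hmono : ∀ x x' : Joint d, (∀ i, x i ∈ Γ.X i) → (∀ i, x' i ∈ Γ.X i) →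
      c * ∑ i, ‖x i - x' i‖ ^ 2 ≤ ∑ i, inner ℝ (Γ.G x i - Γ.G x' i) (x i - x' i))
    (hs : ∀ t i, ‖q t i + gradMul (Γ.g i) ((st t).x i)
      (pushSum (W t) (st (t + 1)).z (st t).mu i)‖ ≤ Cs / b t)
    {xs : Joint d} {lam : Vec m} (hfeas : xs ∈ Γ.feasible) (hkkt : Γ.IsKKT xs lam) (t : ℕ) :
    c * sqDist (st t).x xs ≤
      (sqDist (st t).x xs - sqDist (st (t + 1)).x xs) * (b t ^ 3)⁻¹ / 2
      + (dualPotential st lam t - dualPotential st lam (t + 1)) * (b t)⁻¹ / 2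
      + b t * (N * Cs ^ 2 / 2 + (N * (N * ‖lam‖ ^ 2 + ((N + 1) * B) ^ 2 / zmin)) / 2)
      + B * disagreement W st (fun t => (st t).mu) t
      + Lf * B * disagreement W st (fun t => (st t).sig) t
      + gradientNoise Γ W q st xs t := by
  have hbt := hb.pos t
  have hm := hmono (st t).x xs (h.x_mem t) hfeas.1
  have hk := hkkt.inner_G_ge hΓ hfeas (h.x_mem t)
  have hlam : lam ∈ orthant m := hkkt.2.1
  have hv := h.sum_inner_pushSum_g_le hB hfeas t
  have hd := h.dualPotential_succ_le hb hW hB hzmin hz hzN hlam t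
  set v := pushSum (W t) (st (t + 1)).z (st t).mu with hvdef
  set y := pushSum (W t) (st (t + 1)).z (st t).sig with hydef
  have hvpos : ∀ i, v i ∈ orthant m := fun i =>
    smul_mem_orthant (inv_nonneg.2 (hzmin.le.trans (hz _ _)))
      (sum_smul_mem_orthant (hW.nonneg t i) (h.mu_mem_orthant t))
  have hagg : Γ.agg (st t).x = (1 / (N : ℝ)) • ∑ j, (st t).sig j := by
    rw [h.sum_sig_eq hW]; rfl
  have hi : ∀ i, inner ℝ (Γ.G (st t).x i) ((st t).x i - xs i) ≤
      ((‖(st t).x i - xs i‖ ^ 2 - ‖(st (t + 1)).x i - xs i‖ ^ 2) * (b t ^ 3)⁻¹ / 2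
        + b t * (Cs ^ 2 / 2))
      + inner ℝ (q t i - Γ.p i ((st t).x i) (y i)) (xs i - (st t).x i)
      - inner ℝ (Γ.g i ((st t).x i)) (v i) + inner ℝ (v i) (Γ.g i (xs i))
      + Lf * B * ‖y i - (1 / (N : ℝ)) • ∑ j, (st t).sig j‖ := by
    intro i
    have h1 := primal_step_le (hΓ.compact i) (hΓ.convex i) (x := (st t).x i) (hfeas.1 i)
      (q t i + gradMul (Γ.g i) ((st t).x i) (v i)) (a := b t ^ 3) (by positivity)
    rw [← h.x_succ] at h1
    have h2 : b t ^ 3 / 2 * ‖q t i + gradMul (Γ.g i) ((st t).x i) (v i)‖ ^ 2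
        ≤ b t * (Cs ^ 2 / 2) := by
      calc _ ≤ b t ^ 3 / 2 * (Cs / b t) ^ 2 :=
            mul_le_mul_of_nonneg_left (pow_le_pow_left₀ (norm_nonneg _) (hs t i) 2) (by positivity)
        _ = _ := by field_simp
    have h3 := inner_gradMul_le (hΓ.convex_g i) (h.x_mem t i) (hfeas.1 i)
      (hΓ.diff_g i _ (h.x_mem t i)) (hvpos i)
    have h4 : inner ℝ (Γ.p i ((st t).x i) (y i) - Γ.p i ((st t).x i) (Γ.agg (st t).x))
        (xs i - (st t).x i) ≤ Lf * B * ‖y i - (1 / (N : ℝ)) • ∑ j, (st t).sig j‖ := by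
      refine (real_inner_le_norm _ _).trans ?_
      have h5 := hp i _ (h.x_mem t i) (y i) (Γ.agg (st t).x)
      have h6 := hB.diam_le i _ (hfeas.1 i) _ (h.x_mem t i)
      rw [hagg] at h5 ⊢
      calc _ ≤ (Lf * ‖y i - (1 / (N : ℝ)) • ∑ j, (st t).sig j‖) * B :=
            mul_le_mul h5 h6 (norm_nonneg _) (mul_nonneg hLf (norm_nonneg _))
        _ = _ := by ring
    -- Exact splitting into the update direction, the gradient noise, the constraint part and the
    -- error of the estimated aggregate.
    have h7 : inner ℝ (Γ.G (st t).x i) ((st t).x i - xs i)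
        = inner ℝ (q t i + gradMul (Γ.g i) ((st t).x i) (v i)) ((st t).x i - xs i)
          + inner ℝ (q t i - Γ.p i ((st t).x i) (y i)) (xs i - (st t).x i)
          + inner ℝ (gradMul (Γ.g i) ((st t).x i) (v i)) (xs i - (st t).x i)
          + inner ℝ (Γ.p i ((st t).x i) (y i) - Γ.p i ((st t).x i) (Γ.agg (st t).x))
              (xs i - (st t).x i) := by
      rw [← neg_sub (xs i) ((st t).x i)]
      simp only [AggGame.G, inner_neg_right, inner_add_left, inner_sub_left]
      ring
    rw [inner_sub_right (v i)] at h3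
    rw [real_inner_comm (v i)]
    linarith
  have hsum := Finset.sum_le_sum fun i (_ : i ∈ Finset.univ) => hi i
  have hd1 : ∑ i, inner ℝ (Γ.g i ((st t).x i)) (v i - lam)
      = ∑ i, inner ℝ (Γ.g i ((st t).x i)) (v i) - inner ℝ lam (Γ.coupled (st t).x) := by
    simp only [inner_sub_right, Finset.sum_sub_distrib, AggGame.coupled, inner_sum]
    congr 1
    exact Finset.sum_congr rfl fun i _ => real_inner_comm _ _
  have hd2 : -∑ i, inner ℝ (Γ.g i ((st t).x i)) (v i - lam)
      ≤ (dualPotential st lam t - dualPotential st lam (t + 1)) * (b t)⁻¹ / 2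
        + b t * ((N * (N * ‖lam‖ ^ 2 + ((N + 1) * B) ^ 2 / zmin)) / 2) := by
    rw [← sub_nonneg]
    have h8 : (dualPotential st lam t - dualPotential st lam (t + 1)) * (b t)⁻¹ / 2
        + b t * ((N * (N * ‖lam‖ ^ 2 + ((N + 1) * B) ^ 2 / zmin)) / 2)
        - -∑ i, inner ℝ (Γ.g i ((st t).x i)) (v i - lam)
        = (dualPotential st lam t + 2 * b t * ∑ i, inner ℝ (Γ.g i ((st t).x i)) (v i - lam)
          + b t ^ 2 * (N * (N * ‖lam‖ ^ 2 + ((N + 1) * B) ^ 2 / zmin))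
          - dualPotential st lam (t + 1)) * ((b t)⁻¹ / 2) := by
      field_simp
      ring
    rw [h8]
    exact mul_nonneg (by linarith) (by positivity)
  simp only [Finset.sum_add_distrib, Finset.sum_sub_distrib, ← Finset.sum_div, ← Finset.sum_mul,
    ← Finset.mul_sum, Finset.sum_const, Finset.card_univ, Fintype.card_fin, nsmul_eq_mul] at hsum
  simp only [inner_sub_left, Finset.sum_sub_distrib] at hm
  rw [hd1] at hd2
  simp only [inner_sub_left, Finset.sum_sub_distrib] at hsum
  simp only [sqDist, gradientNoise, disagreement, inner_sub_left, Finset.sum_sub_distrib,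
    ← hvdef, ← hydef] at hm hv ⊢
  linarith

end IsPrimalDualRun

/-- The regret bound: along every run with bounded gradient estimates, the summed squared
distances to a variational equilibrium are bounded by the summed step sizes and the noise. -/
theorem AggGame.exists_regret_bound {Γ : AggGame N n m d} (hΓ : Γ.Regular)
    (hLip : Γ.LipschitzInAgg) (hMono : Γ.StronglyMonotone)
    {W : ℕ → Matrix (Fin N) (Fin N) ℝ} (hW : GraphAssumption W) {b : ℕ → ℝ} (hb : IsSlowStep b)
    {S : ℝ} (hS : 0 ≤ S) {xs : Joint d} (hxs : Γ.IsVGNE xs) :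
    ∃ c C : ℝ, 0 < c ∧ 0 ≤ C ∧ ∀ q st, IsPrimalDualRun Γ W b q st → (∀ t i, ‖q t i‖ ≤ S) → ∀ T,
      c * ∑ t ∈ Finset.range (T + 1), sqDist (st t).x xs
        ≤ C * ∑ t ∈ Finset.range (T + 1), b t
          + ∑ t ∈ Finset.range (T + 1), IsPrimalDualRun.gradientNoise Γ W q st xs t := by
  obtain ⟨B, hB⟩ := hΓ.exists_boundedBy
  obtain ⟨Lf, hLf, hp⟩ := hLip
  obtain ⟨Ls, hLs, hψ⟩ := hΓ.lip_ψ
  obtain ⟨c, hc, hmono⟩ := hMono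
  obtain ⟨⟨hfeas, -⟩, lam, hkkt⟩ := hxs
  obtain ⟨zmin, Cc, hzmin, hCc, hcons⟩ := hW.exists_consensus
  have hB0 := hB.nonneg
  set Cs : ℝ := S + B * (zmin⁻¹ * (N * B)) with hCs
  have hCs0 : 0 ≤ Cs := by positivity
  set C₁ : ℝ := N * Cs ^ 2 / 2 + (N * (N * ‖lam‖ ^ 2 + ((N + 1) * B) ^ 2 / zmin)) / 2 with hC₁
  have hC₁0 : 0 ≤ C₁ := by positivity
  set Cv : ℝ := N * (N * B + N * ‖lam‖) ^ 2 / zmin with hCv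
  have hCv0 : 0 ≤ Cv := by positivity
  -- In order: primal summation by parts, dual summation by parts, quadratic step errors, multiplier
  -- disagreement, aggregate disagreement. The starting point enters only through `B`.
  refine ⟨c, N * B ^ 2 * 3 / 2 + Cv / 2 + C₁ + B * (Cc * ((N + 1) * B))
    + Lf * B * (Cc * (N * B + Ls * Cs)), hc, by positivity, fun q st h hq T => ?_⟩
  obtain ⟨hz, hzN, hcons⟩ := hcons (fun t => (st t).z) h.z_zero h.z_succ
  have hs : ∀ t i, ‖q t i + gradMul (Γ.g i) ((st t).x i)
      (pushSum (W t) (st (t + 1)).z (st t).mu i)‖ ≤ Cs / b t :=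
    h.norm_direction_le hb hW hB hzmin hz hS hq
  have hsb : ∀ a : ℝ, ∑ t ∈ Finset.range (T + 1), a * b t
      = a * ∑ t ∈ Finset.range (T + 1), b t := fun a => (Finset.mul_sum _ _ _).symm
  -- Since `b 0 = 1`, the initial size of the trackers can be absorbed into the step-size sum.
  have hb1 : 1 ≤ ∑ t ∈ Finset.range (T + 1), b t := by
    rw [← hb.zero]
    exact Finset.single_le_sum (f := b) (fun t _ => (hb.pos t).le) (Finset.mem_range.2 (by omega))
  have hanti : ∀ a : ℝ, 0 ≤ a → Antitone fun t => a * b t := fun a ha s t hst =>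
    mul_le_mul_of_nonneg_left (hb.anti hst) ha
  have hmu : ∑ t ∈ Finset.range (T + 1),
      IsPrimalDualRun.disagreement W st (fun t => (st t).mu) t
        ≤ Cc * ((N + 1) * B) * ∑ t ∈ Finset.range (T + 1), b t := by
    have := hcons (Vec m) (fun t => (st t).mu) (fun t => (N + 1) * B * b t)
      (hanti _ (by positivity)) (fun t => mul_nonneg (by positivity) (hb.pos t).le)
      (h.norm_mu_succ_sub_le hb hW hB) (T + 1)
    simp only [h.mu_zero, norm_zero, Finset.sum_const_zero, zero_add, hsb, ← mul_assoc] at this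
    simpa only [IsPrimalDualRun.disagreement, pushSum, ← mul_assoc] using this
  have hsig : ∑ t ∈ Finset.range (T + 1),
      IsPrimalDualRun.disagreement W st (fun t => (st t).sig) t
        ≤ Cc * (N * B + Ls * Cs) * ∑ t ∈ Finset.range (T + 1), b t := by
    have h1 := hcons (Vec n) (fun t => (st t).sig) (fun t => Ls * Cs * b t)
      (hanti _ (by positivity)) (fun t => mul_nonneg (by positivity) (hb.pos t).le)
      (h.norm_sig_succ_sub_le hΓ hb hLs.le hCs0 hψ hs) (T + 1)
    have h2 : ∑ i, ‖(st 0).sig i‖ ≤ N * B := by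
      refine (Finset.sum_le_sum fun i _ => ?_).trans_eq (b := ∑ _i : Fin N, B) (by simp)
      rw [h.sig_zero]
      exact hB.ψ_le i _ (h.x_mem 0 i)
    have h3 : (N : ℝ) * B ≤ N * B * ∑ t ∈ Finset.range (T + 1), b t :=
      le_mul_of_one_le_right (by positivity) hb1
    rw [hsb] at h1
    refine h1.trans ?_
    rw [mul_assoc Cc]
    refine mul_le_mul_of_nonneg_left ?_ hCc
    linarith
  have hD : ∀ t, sqDist (st t).x xs ≤ N * B ^ 2 := fun t => by
    refine (Finset.sum_le_sum fun i _ => ?_).trans_eq (b := ∑ _i : Fin N, B ^ 2) (by simp)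
    exact pow_le_pow_left₀ (norm_nonneg _) (hB.diam_le i _ (h.x_mem t i) _ (hfeas.1 i)) 2
  have hDsum := sum_sub_mul_le_of_increments (V := fun t => sqDist (st t).x xs)
    (w := fun t => (b t ^ 3)⁻¹) (c := fun t => N * B ^ 2 * 3 * b t)
    (fun t => Finset.sum_nonneg fun i _ => sq_nonneg _)
    (fun t => inv_nonneg.2 (pow_nonneg (hb.pos t).le 3))
    (by
      have := hD 0
      simp only [hb.zero]
      norm_num
      nlinarith [mul_nonneg (Nat.cast_nonneg (α := ℝ) N) (sq_nonneg B)])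
    (fun t => by
      have h1 := hb.inv_pow_three_sub_le t
      have h2 : 0 ≤ (b (t + 1) ^ 3)⁻¹ - (b t ^ 3)⁻¹ := sub_nonneg.2 (inv_anti₀
        (pow_pos (hb.pos _) 3) (pow_le_pow_left₀ (hb.pos _).le (hb.anti (Nat.le_succ t)) 3))
      rw [mul_assoc (N * B ^ 2 : ℝ)]
      exact mul_le_mul (hD _) h1 h2 (by positivity)) T
  -- The potential may grow like b⁻², but the weight 1/b increases only by b³, so each product is at
  -- most `Cv * b`.
  have hVsum := sum_sub_mul_le_of_increments (V := IsPrimalDualRun.dualPotential st lam)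
    (w := fun t => (b t)⁻¹) (c := fun t => Cv * b t)
    (IsPrimalDualRun.dualPotential_nonneg hzmin hz lam)
    (fun t => inv_nonneg.2 (hb.pos t).le)
    (by simpa [hb.zero] using h.dualPotential_le hb hW hB hzmin hz hzN lam 0)
    (fun t => by
      have hbt := hb.pos (t + 1)
      have h1 := hb.inv_sub_le t
      have h2 : 0 ≤ (b (t + 1))⁻¹ - (b t)⁻¹ := sub_nonneg.2 (inv_anti₀
        hbt (hb.anti (Nat.le_succ t)))
      refine (mul_le_mul (h.dualPotential_le hb hW hB hzmin hz hzN lam (t + 1)) h1 h2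
        (by positivity)).trans_eq ?_
      simp only [← hCv]
      field_simp) T
  have hstep := Finset.sum_le_sum fun t (_ : t ∈ Finset.range (T + 1)) =>
    h.regret_step hΓ hb hW hB hzmin hz hzN hLf.le hp hmono hs hfeas hkkt t
  simp only [Finset.sum_add_distrib, ← Finset.mul_sum, ← Finset.sum_div, ← Finset.sum_mul,
    ← hC₁] at hstep
  simp only [hsb] at hDsum hVsum
  have e1 := mul_le_mul_of_nonneg_left hmu hB0
  have e2 := mul_le_mul_of_nonneg_left hsig (mul_nonneg hLf.le hB0)
  linarith

end Regret

/-! ### Adaptedness of the run to the sample filtration. -/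

section Measurability

variable {Ω : Type*} [MeasurableSpace Ω]

lemma measurable_vec_of_inner {k : ℕ} {v : Ω → Vec k}
    (h : ∀ e : Vec k, Measurable fun ω => (inner ℝ (v ω) e : ℝ)) : Measurable v := by
  have h1 : ∀ ω, v ω = ∑ j, (inner ℝ (v ω) (EuclideanSpace.single j (1 : ℝ)) : ℝ) •
      EuclideanSpace.single j (1 : ℝ) := fun ω => by
    have := (EuclideanSpace.basisFun (Fin k) ℝ).sum_repr' (v ω)
    simp only [EuclideanSpace.basisFun_apply] at this
    conv_lhs => rw [← this]
    exact Finset.sum_congr rfl fun j _ => by rw [real_inner_comm]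
  rw [funext h1]
  exact Finset.measurable_fun_sum _ fun j _ => (h _).smul_const _

/-- Each component of the gradient is a pointwise limit of difference quotients with increments `(r
: ℝ)⁻¹ • e`. Differentiability is needed only at `u ω` itself. -/
lemma measurable_gradient_of_measurable {k : ℕ} {H : Ω → Vec k → ℝ} {u : Ω → Vec k}
    (hH : ∀ e : Vec k, Measurable fun ω => H ω (u ω + e))
    (hd : ∀ ω, DifferentiableAt ℝ (H ω) (u ω)) :
    Measurable fun ω => gradient (H ω) (u ω) := by
  refine measurable_vec_of_inner fun e => ?_
  simp only [inner_gradient_left]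
  refine measurable_of_tendsto_metrizable
    (f := fun (r : ℕ) ω => (r : ℝ) • (H ω (u ω + (r : ℝ)⁻¹ • e) - H ω (u ω))) (fun r => ?_) ?_
  · have h0 := hH 0
    simp only [add_zero] at h0
    exact ((hH _).sub h0).const_smul (r : ℝ)
  · refine tendsto_pi_nhds.2 fun ω => ?_
    exact ((hd ω).hasFDerivAt.lim_real e).comp tendsto_natCast_atTop_atTop

lemma Measurable.gradMul {a b : ℕ} (φ : Vec a → Vec b) {x : Ω → Vec a} (hx : Measurable x)
    {v : Ω → Vec b} (hv : Measurable v) : Measurable fun ω => gradMul φ (x ω) (v ω) := by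
  refine measurable_vec_of_inner fun e => ?_
  simp only [_root_.gradMul, ContinuousLinearMap.adjoint_inner_left]
  exact hv.inner ((measurable_fderiv_apply_const ℝ φ e).comp hx)

lemma ContinuousOn.measurable_comp {a b : ℕ} {K : Set (Vec a)} {φ : Vec a → Vec b}
    (hφ : ContinuousOn φ K) {x : Ω → Vec a} (hx : Measurable x) (hK : ∀ ω, x ω ∈ K) :
    Measurable fun ω => φ (x ω) :=
  (continuousOn_iff_continuous_domRestrict.1 hφ).measurable.comp (hx.subtype_mk (h := hK))

lemma measurable_metricProj {k : ℕ} {K : Set (Vec k)} (hne : K.Nonempty) (hK : IsCompact K)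
    (hc : Convex ℝ K) : Measurable (metricProj K) := by
  have : LipschitzWith 1 (metricProj K) := LipschitzWith.of_dist_le_mul fun u v => by
    simpa [dist_eq_norm] using norm_metricProj_sub_le hne hK hc u v
  exact this.continuous.measurable

lemma measurable_posPartVec {k : ℕ} : Measurable (posPartVec (k := k)) := by
  have : LipschitzWith 1 (posPartVec (k := k)) := LipschitzWith.of_dist_le_mul fun u v => by
    rw [dist_eq_norm, dist_eq_norm, NNReal.coe_one, one_mul, EuclideanSpace.norm_eq,
      EuclideanSpace.norm_eq]
    refine Real.sqrt_le_sqrt (Finset.sum_le_sum fun j _ => ?_)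
    simp only [posPartVec, PiLp.sub_apply, Real.norm_eq_abs]
    exact pow_le_pow_left₀ (abs_nonneg _) (abs_max_sub_max_le_abs _ _ _) 2
  exact this.continuous.measurable

variable {N n m : ℕ} {d k : Fin N → ℕ}

lemma measurable_sampledGrad {Γ : AggGame N n m d}
    {F : ∀ i, ℕ → Vec (d i) → Vec n → Vec (k i) → ℝ} {i : Fin N} {t : ℕ}
    (hF : Measurable fun w : Vec (d i) × Vec n × Vec (k i) => F i t w.1 w.2.1 w.2.2)
    (hd : ∀ x ∈ Γ.X i, ∀ (y : Vec n) (ζ : Vec (k i)),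
      DifferentiableAt ℝ (fun w : Vec (d i) × Vec n => F i t w.1 w.2 ζ) (x, y))
    {x : Ω → Vec (d i)} {y : Ω → Vec n} {ζ : Ω → Vec (k i)} (hx : Measurable x)
    (hy : Measurable y) (hζ : Measurable ζ) (hX : ∀ ω, x ω ∈ Γ.X i) :
    Measurable fun ω => sampledGrad Γ F i t (x ω) (y ω) (ζ ω) := by
  unfold sampledGrad aggGrad
  refine Measurable.add ?_ (Measurable.fun_const_smul (Measurable.gradMul _ hx ?_) _)
  · refine measurable_gradient_of_measurable (H := fun ω u => F i t u (y ω) (ζ ω))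
      (fun e => ?_) fun ω => ?_
    · exact hF.comp ((hx.add_const e).prodMk (hy.prodMk hζ))
    · exact DifferentiableAt.comp (g := fun w : Vec (d i) × Vec n => F i t w.1 w.2 (ζ ω))
        (f := fun u => (u, y ω)) (x ω) (hd _ (hX ω) (y ω) (ζ ω)) (by fun_prop)
  · refine measurable_gradient_of_measurable (H := fun ω v => F i t (x ω) v (ζ ω))
      (fun e => ?_) fun ω => ?_
    · exact hF.comp (hx.prodMk ((hy.add_const e).prodMk hζ))
    · exact DifferentiableAt.comp (g := fun w : Vec (d i) × Vec n => F i t w.1 w.2 (ζ ω))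
        (f := fun v => (x ω, v)) (y ω) (hd _ (hX ω) (y ω) (ζ ω)) (by fun_prop)

/-- All components of a random state are measurable. -/
structure PDState.IsMeasurable (st : Ω → PDState n m d) : Prop where
  z : ∀ i, Measurable fun ω => (st ω).z i
  x : ∀ i, Measurable fun ω => (st ω).x i
  mu : ∀ i, Measurable fun ω => (st ω).mu i
  sig : ∀ i, Measurable fun ω => (st ω).sig i

lemma PDState.IsMeasurable.mono {Ω : Type*} {m₁ m₂ : MeasurableSpace Ω} (h : m₁ ≤ m₂)
    {st : Ω → PDState n m d} (hst : @PDState.IsMeasurable Ω m₁ N n m d st) :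
    @PDState.IsMeasurable Ω m₂ N n m d st :=
  @IsMeasurable.mk Ω m₂ N n m d st (fun i => (@z Ω m₁ N n m d st hst i).mono h le_rfl)
    (fun i => (@x Ω m₁ N n m d st hst i).mono h le_rfl)
    (fun i => (@mu Ω m₁ N n m d st hst i).mono h le_rfl)
    (fun i => (@sig Ω m₁ N n m d st hst i).mono h le_rfl)

lemma PDState.IsMeasurable.z_step {st : Ω → PDState n m d} (h : PDState.IsMeasurable st)
    (A : Matrix (Fin N) (Fin N) ℝ) (i : Fin N) :
    Measurable fun ω => ∑ j, A i j * (st ω).z j :=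
  Finset.measurable_fun_sum _ fun j _ => (h.z j).const_mul _

lemma PDState.IsMeasurable.pushSum_sig {st : Ω → PDState n m d} (h : PDState.IsMeasurable st)
    (A : Matrix (Fin N) (Fin N) ℝ) (i : Fin N) :
    Measurable fun ω => pushSum A (fun i => ∑ j, A i j * (st ω).z j) (st ω).sig i :=
  (h.z_step A i).inv.smul (Finset.measurable_fun_sum _ fun j _ => (h.sig j).fun_const_smul _)

lemma PDState.IsMeasurable.pushSum_mu {st : Ω → PDState n m d} (h : PDState.IsMeasurable st)
    (A : Matrix (Fin N) (Fin N) ℝ) (i : Fin N) :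
    Measurable fun ω => pushSum A (fun i => ∑ j, A i j * (st ω).z j) (st ω).mu i :=
  (h.z_step A i).inv.smul (Finset.measurable_fun_sum _ fun j _ => (h.mu j).fun_const_smul _)

lemma pdStep_x_mem {Γ : AggGame N n m d} (hΓ : Γ.Regular)
    (F : ∀ i, ℕ → Vec (d i) → Vec n → Vec (k i) → ℝ) (W : ℕ → Matrix (Fin N) (Fin N) ℝ)
    (α β γ : ℕ → ℝ) (t : ℕ) (ζ : ∀ i, Vec (k i)) (st : PDState n m d) (i : Fin N) :
    (pdStep Γ F W α β γ t ζ st).x i ∈ Γ.X i :=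
  (metricProj_spec (hΓ.nonempty i) (hΓ.compact i) _).1

lemma PDState.IsMeasurable.pdStep {Γ : AggGame N n m d} (hΓ : Γ.Regular)
    {F : ∀ i, ℕ → Vec (d i) → Vec n → Vec (k i) → ℝ}
    (hF : ∀ i t, Measurable fun w : Vec (d i) × Vec n × Vec (k i) => F i t w.1 w.2.1 w.2.2)
    (hd : ∀ i t, ∀ x ∈ Γ.X i, ∀ (y : Vec n) (ζ : Vec (k i)),
      DifferentiableAt ℝ (fun w : Vec (d i) × Vec n => F i t w.1 w.2 ζ) (x, y))
    (W : ℕ → Matrix (Fin N) (Fin N) ℝ) (α β γ : ℕ → ℝ) (t : ℕ)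
    {ζ : Ω → ∀ i, Vec (k i)} (hζ : ∀ i, Measurable fun ω => ζ ω i)
    {st : Ω → PDState n m d} (h : PDState.IsMeasurable st) (hX : ∀ ω i, (st ω).x i ∈ Γ.X i) :
    PDState.IsMeasurable fun ω => pdStep Γ F W α β γ t (ζ ω) (st ω) := by
  have hψ : ∀ i, ContinuousOn (Γ.ψ i) (Γ.X i) := fun i x hx =>
    (hΓ.diff_ψ i x hx).continuousAt.continuousWithinAt
  have hg : ∀ i, ContinuousOn (Γ.g i) (Γ.X i) := fun i x hx =>
    (hΓ.diff_g i x hx).continuousAt.continuousWithinAt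
  have hx' : ∀ i, Measurable fun ω => (_root_.pdStep Γ F W α β γ t (ζ ω) (st ω)).x i := by
    intro i
    refine (measurable_metricProj (hΓ.nonempty i) (hΓ.compact i) (hΓ.convex i)).comp
      ((h.x i).sub (Measurable.fun_const_smul ?_ _))
    exact (measurable_sampledGrad (hF i t) (hd i t) (h.x i) (h.pushSum_sig (W t) i) (hζ i)
      fun ω => hX ω i).add (Measurable.gradMul _ (h.x i) (h.pushSum_mu (W t) i))
  have hmu : ∀ i, Measurable fun ω => ∑ j, W t i j • (st ω).mu j := fun i =>
    Finset.measurable_fun_sum _ fun j _ => (h.mu j).fun_const_smul _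
  refine ⟨h.z_step (W t), hx', fun i => ?_, fun i => ?_⟩
  · refine measurable_posPartVec.comp ((hmu i).add (Measurable.fun_const_smul ?_ _))
    exact ((hg i).measurable_comp (h.x i) fun ω => hX ω i).sub ((hmu i).fun_const_smul _)
  · exact ((Finset.measurable_fun_sum _ fun j _ => (h.sig j).fun_const_smul _).add
      ((hψ i).measurable_comp (hx' i) fun ω => pdStep_x_mem hΓ F W α β γ t (ζ ω) (st ω) i)).sub
      ((hψ i).measurable_comp (h.x i) fun ω => hX ω i)

lemma sampleSigma_mono {Ω : Type*} (ξ : ∀ i, ℕ → Ω → Vec (k i)) {s t : ℕ} (h : s ≤ t) :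
    sampleSigma ξ s ≤ sampleSigma ξ t :=
  iSup_mono fun _ => iSup_mono fun _ => iSup_le fun hr =>
    le_iSup_of_le (hr.trans_le h) le_rfl

lemma sampleSigma_le {ξ : ∀ i, ℕ → Ω → Vec (k i)} (hξ : ∀ i t, Measurable (ξ i t)) (t : ℕ) :
    sampleSigma ξ t ≤ ‹MeasurableSpace Ω› :=
  iSup_le fun i => iSup_le fun s => iSup_le fun _ => (hξ i s).comap_le

lemma measurable_sampleSigma_succ {Ω : Type*} (ξ : ∀ i, ℕ → Ω → Vec (k i)) (i : Fin N) (t : ℕ) :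
    Measurable[sampleSigma ξ (t + 1)] (ξ i t) :=
  Measurable.mono (comap_measurable (ξ i t))
    (le_iSup_of_le i (le_iSup_of_le t (le_iSup_of_le (Nat.lt_succ_self t) le_rfl))) le_rfl

lemma pdRun_x_mem {Γ : AggGame N n m d} (hΓ : Γ.Regular)
    (F : ∀ i, ℕ → Vec (d i) → Vec n → Vec (k i) → ℝ) (W : ℕ → Matrix (Fin N) (Fin N) ℝ)
    (α β γ : ℕ → ℝ) {x0 : Joint d} (hx0 : ∀ i, x0 i ∈ Γ.X i) (ζ : ∀ i, ℕ → Vec (k i)) (t : ℕ)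
    (i : Fin N) : (pdRun Γ F W α β γ x0 ζ t).x i ∈ Γ.X i := by
  cases t with
  | zero => exact hx0 i
  | succ t => exact pdStep_x_mem hΓ F W α β γ t _ _ i

/-- The state at time `t` depends measurably on the samples before time `t`. -/
lemma pdRun_isMeasurable {Ω : Type*} {Γ : AggGame N n m d} (hΓ : Γ.Regular)
    {F : ∀ i, ℕ → Vec (d i) → Vec n → Vec (k i) → ℝ}
    (hF : ∀ i t, Measurable fun w : Vec (d i) × Vec n × Vec (k i) => F i t w.1 w.2.1 w.2.2)
    (hd : ∀ i t, ∀ x ∈ Γ.X i, ∀ (y : Vec n) (ζ : Vec (k i)),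
      DifferentiableAt ℝ (fun w : Vec (d i) × Vec n => F i t w.1 w.2 ζ) (x, y))
    (W : ℕ → Matrix (Fin N) (Fin N) ℝ) (α β γ : ℕ → ℝ) {x0 : Joint d}
    (hx0 : ∀ i, x0 i ∈ Γ.X i) (ξ : ∀ i, ℕ → Ω → Vec (k i)) (t : ℕ) :
    @PDState.IsMeasurable Ω (sampleSigma ξ t) N n m d
      fun ω => pdRun Γ F W α β γ x0 (fun i s => ξ i s ω) t := by
  induction t with
  | zero =>
    exact @PDState.IsMeasurable.mk Ω (sampleSigma ξ 0) N n m d _ (fun i => measurable_const)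
      (fun i => measurable_const) (fun i => measurable_const) (fun i => measurable_const)
  | succ t ih =>
    exact @PDState.IsMeasurable.pdStep Ω (sampleSigma ξ (t + 1)) N n m d k Γ hΓ F hF hd W α β γ t
      (fun ω i => ξ i t ω) (fun i => measurable_sampleSigma_succ ξ i t) _
      (ih.mono (sampleSigma_mono ξ (Nat.le_succ t)))
      fun ω i => pdRun_x_mem hΓ F W α β γ hx0 _ t i

end Measurability

/-! ### An Azuma–Hoeffding bound. -/

section Martingale

variable {Ω : Type*} {mΩ : MeasurableSpace Ω} {P : Measure Ω} [IsProbabilityMeasure P]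
  {𝓖 : ℕ → MeasurableSpace Ω} {D : ℕ → Ω → ℝ} {R : ℝ}

lemma stronglyMeasurable_sum_of_adapted (hmono : Monotone 𝓖)
    (hD : ∀ t, StronglyMeasurable[𝓖 (t + 1)] (D t)) (T : ℕ) :
    StronglyMeasurable[𝓖 T] fun ω => ∑ t ∈ Finset.range T, D t ω :=
  Finset.stronglyMeasurable_fun_sum _ fun t ht =>
    (hD t).mono (hmono (Nat.succ_le_of_lt (Finset.mem_range.1 ht)))

lemma integrable_exp_mul_sum (hle : ∀ t, 𝓖 t ≤ mΩ)
    (hD : ∀ t, StronglyMeasurable[𝓖 (t + 1)] (D t)) (hbd : ∀ t, ∀ᵐ ω ∂P, |D t ω| ≤ R)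
    (l : ℝ) (T : ℕ) :
    Integrable (fun ω => Real.exp (l * ∑ t ∈ Finset.range T, D t ω)) P := by
  have hm : Measurable fun ω => ∑ t ∈ Finset.range T, D t ω :=
    Finset.measurable_fun_sum _ fun t _ => ((hD t).mono (hle _)).measurable
  refine Integrable.of_bound (C := Real.exp (|l| * (T * R)))
    (hm.const_mul l).exp.aestronglyMeasurable ?_
  filter_upwards [ae_all_iff.2 hbd] with ω hω
  rw [Real.norm_of_nonneg (Real.exp_pos _).le, Real.exp_le_exp]
  have h1 : |∑ t ∈ Finset.range T, D t ω| ≤ T * R := by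
    refine (Finset.abs_sum_le_sum_abs _ _).trans ((Finset.sum_le_sum fun t _ => hω t).trans ?_)
    simp
  calc l * ∑ t ∈ Finset.range T, D t ω ≤ |l * ∑ t ∈ Finset.range T, D t ω| := le_abs_self _
    _ ≤ _ := by rw [abs_mul]; exact mul_le_mul_of_nonneg_left h1 (abs_nonneg _)

/-- The exponential moments of a sum of bounded martingale differences. -/
lemma integral_exp_mul_sum_le (hle : ∀ t, 𝓖 t ≤ mΩ) (hmono : Monotone 𝓖) (hR : 0 < R)
    (hD : ∀ t, StronglyMeasurable[𝓖 (t + 1)] (D t)) (hbd : ∀ t, ∀ᵐ ω ∂P, |D t ω| ≤ R)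
    (hcond : ∀ t, P[D t | 𝓖 t] =ᵐ[P] 0) (l : ℝ) (T : ℕ) :
    ∫ ω, Real.exp (l * ∑ t ∈ Finset.range T, D t ω) ∂P
      ≤ Real.exp ((l * R) ^ 2 / 2) ^ T := by
  induction T with
  | zero => simp
  | succ T ih =>
    set h : Ω → ℝ := fun ω => Real.exp (l * ∑ t ∈ Finset.range T, D t ω) with hh
    have hint : Integrable h P := integrable_exp_mul_sum hle hD hbd l T
    have hDint : Integrable (D T) P :=
      Integrable.of_bound (C := R) ((hD T).mono (hle _)).aestronglyMeasurable (hbd T)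
    have hmeas : StronglyMeasurable[𝓖 T] h :=
      Real.continuous_exp.comp_stronglyMeasurable
        ((stronglyMeasurable_sum_of_adapted hmono hD T).const_mul l)
    have hhD : Integrable (fun ω => h ω * D T ω) P :=
      hint.mul_bdd ((hD T).mono (hle _)).aestronglyMeasurable (hbd T)
    -- `h` depends only on the past, so it can be pulled out of the conditional expectation of `D
    -- T`.
    have hzero : ∫ ω, h ω * D T ω ∂P = 0 := by
      rw [← integral_condExp (hle T)]
      have h1 := condExp_mul_of_stronglyMeasurable_left (μ := P) hmeas hhD hDint
      have h2 : P[fun ω => h ω * D T ω | 𝓖 T] =ᵐ[P] 0 := by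
        filter_upwards [h1, hcond T] with ω e1 e2
        have e1' : (P[fun ω => h ω * D T ω | 𝓖 T]) ω = h ω * (P[D T | 𝓖 T]) ω := e1
        rw [e1', e2]
        simp
      rw [integral_congr_ae h2]
      simp
    calc ∫ ω, Real.exp (l * ∑ t ∈ Finset.range (T + 1), D t ω) ∂P
        ≤ ∫ ω, (Real.cosh (l * R) * h ω + Real.sinh (l * R) / R * (h ω * D T ω)) ∂P := by
          refine integral_mono_ae (integrable_exp_mul_sum hle hD hbd l (T + 1))
            ((hint.const_mul _).add (hhD.const_mul _)) ?_
          filter_upwards [hbd T] with ω hω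
          have h1 : |D T ω / R| ≤ 1 := by rwa [abs_div, abs_of_pos hR, div_le_one hR]
          -- The exponential lies below its chord on [−R, R]; the linear part of the chord
          -- integrates to zero.
          have h2 := Real.exp_mul_le_cosh_add_mul_sinh h1 (l * R)
          have h3 : D T ω / R * (l * R) = l * D T ω := by field_simp
          rw [h3] at h2
          calc Real.exp (l * ∑ t ∈ Finset.range (T + 1), D t ω) = h ω * Real.exp (l * D T ω) := by
                rw [Finset.sum_range_succ, mul_add, Real.exp_add]
            _ ≤ h ω * (Real.cosh (l * R) + D T ω / R * Real.sinh (l * R)) :=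
                mul_le_mul_of_nonneg_left h2 (Real.exp_pos _).le
            _ = _ := by ring
      _ = Real.cosh (l * R) * ∫ ω, h ω ∂P := by
          rw [integral_add (hint.const_mul _) (hhD.const_mul _), integral_const_mul,
            integral_const_mul, hzero, mul_zero, add_zero]
      _ ≤ Real.exp ((l * R) ^ 2 / 2) * Real.exp ((l * R) ^ 2 / 2) ^ T :=
          mul_le_mul (Real.cosh_le_exp_half_sq _) ih
            (integral_nonneg fun ω => (Real.exp_pos _).le) (Real.exp_pos _).le
      _ = _ := (pow_succ' _ _).symm

/-- A tail bound of Azuma–Hoeffding type. -/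
lemma measure_sum_ge_le_of_bounded_differences (hle : ∀ t, 𝓖 t ≤ mΩ) (hmono : Monotone 𝓖)
    (hR : 0 < R) (hD : ∀ t, StronglyMeasurable[𝓖 (t + 1)] (D t))
    (hbd : ∀ t, ∀ᵐ ω ∂P, |D t ω| ≤ R) (hcond : ∀ t, P[D t | 𝓖 t] =ᵐ[P] 0)
    {δ : ℝ} (hδ : 0 < δ) {T : ℕ} (hT : 0 < T) :
    P.real {ω | R * √T * (Real.log (1 / δ) + 1 / 2) ≤ ∑ t ∈ Finset.range T, D t ω} ≤ δ := by
  have hTR : (0 : ℝ) < T := by exact_mod_cast hT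
  have hsq : √(T : ℝ) ^ 2 = T := Real.sq_sqrt hTR.le
  have hs : 0 < √(T : ℝ) := Real.sqrt_pos.2 hTR
  -- A choice independent of `δ`: it makes the exponential moment at most e^{1/2}, at the price of
  -- ln(1/δ) instead of its square root.
  set l : ℝ := (R * √T)⁻¹ with hl
  have hl0 : 0 < l := by positivity
  refine (measure_ge_le_exp_mul_mgf _ hl0.le
    (integrable_exp_mul_sum hle hD hbd l T)).trans ?_
  have h1 : mgf (fun ω => ∑ t ∈ Finset.range T, D t ω) P l ≤ Real.exp (1 / 2) := by
    refine (integral_exp_mul_sum_le hle hmono hR hD hbd hcond l T).trans_eq ?_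
    rw [← Real.exp_nat_mul]
    congr 1
    rw [hl]
    field_simp
    rw [hsq]
  calc _ ≤ Real.exp (-l * (R * √T * (Real.log (1 / δ) + 1 / 2))) * Real.exp (1 / 2) :=
        mul_le_mul_of_nonneg_left h1 (Real.exp_pos _).le
    _ = Real.exp (Real.log δ) := by
        rw [← Real.exp_add]
        congr 1
        rw [hl, one_div δ, Real.log_inv]
        field_simp
        ring
    _ = δ := Real.exp_log hδ

end Martingale

/-! ### Gradient errors as centred random variables. -/

section Noise

variable {Ω : Type*} {mΩ : MeasurableSpace Ω} {P : Measure Ω}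

lemma ae_abs_sub_condExp_le (m : MeasurableSpace Ω) {Y : Ω → ℝ} {R : ℝ}
    (hY : ∀ᵐ ω ∂P, |Y ω| ≤ R) : ∀ᵐ ω ∂P, |(Y - P[Y | m]) ω| ≤ 2 * R := by
  filter_upwards [hY, ae_bdd_abs_condExp_of_ae_bdd_abs (m := m) hY] with ω h1 h2
  rw [Pi.sub_apply]
  linarith [abs_sub (Y ω) ((P[Y | m]) ω)]

variable [IsProbabilityMeasure P]

lemma condExp_sub_condExp_self {m : MeasurableSpace Ω} (hm : m ≤ mΩ) {Y : Ω → ℝ}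
    (hY : Integrable Y P) : P[Y - P[Y | m] | m] =ᵐ[P] 0 := by
  have h1 := condExp_sub hY (integrable_condExp (μ := P) (m := m) (f := Y)) m
  have h2 := condExp_of_stronglyMeasurable hm stronglyMeasurable_condExp
    (integrable_condExp (μ := P) (m := m) (f := Y))
  rw [h2, sub_self] at h1
  exact h1

/-- As `v` is known to `m`, it passes through the conditional expectation, so ⟨p, v⟩ is that of ⟨q,
v⟩. This centres the noise without requiring measurability of `p`. -/
lemma inner_sub_ae_eq_sub_condExp {m : MeasurableSpace Ω} (hm : m ≤ mΩ) {k : ℕ}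
    {q p v : Ω → Vec k} {S B : ℝ} (hq : Measurable[mΩ] q) (hqS : ∀ᵐ ω ∂P, ‖q ω‖ ≤ S)
    (hp : P[q | m] =ᵐ[P] p) (hv : Measurable[m] v) (hvB : ∀ ω, ‖v ω‖ ≤ B) :
    (fun ω => (inner ℝ (q ω - p ω) (v ω) : ℝ))
      =ᵐ[P] fun ω => inner ℝ (q ω) (v ω) - (P[fun ω => inner ℝ (q ω) (v ω) | m]) ω := by
  have hqi : Integrable q P := Integrable.of_bound (C := S) hq.aestronglyMeasurable hqS
  have hint : Integrable (fun ω => (inner ℝ (q ω) (v ω) : ℝ)) P := by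
    refine Integrable.of_bound (C := S * B) (hq.inner (hv.mono hm le_rfl)).aestronglyMeasurable ?_
    filter_upwards [hqS] with ω hω
    exact (norm_inner_le_norm _ _).trans
      (mul_le_mul hω (hvB ω) (norm_nonneg _) ((norm_nonneg _).trans hω))
  have h := condExp_bilin_of_aestronglyMeasurable_right (μ := P) (m := m) (innerSL ℝ) (f := q)
    (g := v) hv.aestronglyMeasurable hint hqi
  filter_upwards [h, hp] with ω h1 h2
  have h1' : (P[fun ω => (inner ℝ (q ω) (v ω) : ℝ) | m]) ω
      = inner ℝ ((P[q | m]) ω) (v ω) := h1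
  rw [h1', h2, inner_sub_left]

end Noise

/-! ### From regret and noise to the rate. -/

section Assembly

variable {N n m : ℕ} {d k : Fin N → ℕ}

/-- The sampled gradients along the run on the samples `ζ`. -/
noncomputable def runGradient (Γ : AggGame N n m d)
    (F : ∀ i, ℕ → Vec (d i) → Vec n → Vec (k i) → ℝ) (W : ℕ → Matrix (Fin N) (Fin N) ℝ)
    (st : ℕ → PDState n m d) (ζ : ∀ i, ℕ → Vec (k i)) (t : ℕ) : Joint d := fun i =>
  sampledGrad Γ F i t ((st t).x i)
    (pushSum (W t) (fun i => ∑ j, W t i j * (st t).z j) (st t).sig i) (ζ i t)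

/-- The recursions hold by definition; the primal one also needs α_t = b_t³, which is true at t = 0
as well because both sides are 1. -/
lemma pdRun_isPrimalDualRun {Γ : AggGame N n m d} (hΓ : Γ.Regular)
    (F : ∀ i, ℕ → Vec (d i) → Vec n → Vec (k i) → ℝ) (W : ℕ → Matrix (Fin N) (Fin N) ℝ)
    {x0 : Joint d} (hx0 : ∀ i, x0 i ∈ Γ.X i) (ζ : ∀ i, ℕ → Vec (k i)) :
    IsPrimalDualRun Γ W (polyStep (1 / 4))
      (runGradient Γ F W
        (pdRun Γ F W (polyStep (3 / 4)) (polyStep (1 / 4)) (polyStep (1 / 4)) x0 ζ) ζ)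
      (pdRun Γ F W (polyStep (3 / 4)) (polyStep (1 / 4)) (polyStep (1 / 4)) x0 ζ) where
  z_zero := fun _ => rfl
  mu_zero := fun _ => rfl
  sig_zero := fun _ => rfl
  x_mem := pdRun_x_mem hΓ F W _ _ _ hx0 ζ
  z_succ := fun _ _ => rfl
  x_succ := fun t i => by rw [← polyStep_three_quarters]; rfl
  mu_succ := fun _ _ => rfl
  sig_succ := fun _ _ => rfl

lemma sqDist_avgDecision_le (x : ℕ → Joint d) (y : Joint d) {T : ℕ} (hT : 1 ≤ T) :
    sqDist (avgDecision x T) y ≤ 1 / (T : ℝ) * ∑ t ∈ Finset.Icc 1 T, sqDist (x t) y := by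
  have hTR : (0 : ℝ) < T := by exact_mod_cast hT
  unfold sqDist
  rw [Finset.sum_comm, Finset.mul_sum]
  refine Finset.sum_le_sum fun i _ => ?_
  have h1 : avgDecision x T i - y i = (1 / (T : ℝ)) • ∑ t ∈ Finset.Icc 1 T, (x t i - y i) := by
    simp only [avgDecision, Pi.smul_apply, Finset.sum_apply, Finset.sum_sub_distrib,
      Finset.sum_const, Nat.card_Icc, Nat.add_sub_cancel, smul_sub]
    congr 1
    rw [← Nat.cast_smul_eq_nsmul ℝ, smul_smul, one_div_mul_cancel hTR.ne', one_smul]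
  rw [h1, norm_smul, mul_pow, Real.norm_of_nonneg (by positivity)]
  have h2 : ‖∑ t ∈ Finset.Icc 1 T, (x t i - y i)‖ ^ 2
      ≤ T * ∑ t ∈ Finset.Icc 1 T, ‖x t i - y i‖ ^ 2 := by
    refine (pow_le_pow_left₀ (norm_nonneg _) (norm_sum_le _ _) 2).trans ?_
    simpa using sq_sum_le_card_mul_sum_sq (s := Finset.Icc 1 T) (f := fun t => ‖x t i - y i‖)
  calc (1 / (T : ℝ)) ^ 2 * ‖∑ t ∈ Finset.Icc 1 T, (x t i - y i)‖ ^ 2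
      ≤ (1 / (T : ℝ)) ^ 2 * (T * ∑ t ∈ Finset.Icc 1 T, ‖x t i - y i‖ ^ 2) :=
        mul_le_mul_of_nonneg_left h2 (by positivity)
    _ = _ := by field_simp

lemma rate_of_regret {x : ℕ → Joint d} {y : Joint d} {c C R L : ℝ} (hc : 0 < c) (hC : 0 ≤ C)
    (hR : 0 ≤ R) (hL : 0 ≤ L) {T : ℕ} (hT : 1 ≤ T)
    (h : c * ∑ t ∈ Finset.range (T + 1), sqDist (x t) y
      ≤ C * ∑ t ∈ Finset.range (T + 1), polyStep (1 / 4) t + R * √((T + 1 : ℕ) : ℝ) * (L + 1 / 2)) :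
    sqDist (avgDecision x T) y ≤ (3 * C + 2 * R) / c
      * ((T : ℝ) ^ (-(1 / 4) : ℝ) + (T : ℝ) ^ (-(1 / 4) : ℝ) * L) := by
  have hT1 : (1 : ℝ) ≤ T := by exact_mod_cast hT
  have hstep := sum_polyStep_le T
  rw [Real.rpow_neg (Nat.cast_nonneg T)]
  have hr4 := rpow_quarter_pow_four T
  have hr1 : (1 : ℝ) ≤ (T : ℝ) ^ (1 / 4 : ℝ) := Real.one_le_rpow hT1 (by norm_num)
  set r : ℝ := (T : ℝ) ^ (1 / 4 : ℝ)
  have hr0 : 0 < r := by linarith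
  have hr3 : 1 ≤ r ^ 3 := one_le_pow₀ hr1
  -- With r = T^{1/4} ≥ 1: T + 1 = r⁴ + 1 ≤ 4r⁶, so the noise is of no larger order than the
  -- step-size sum.
  have hsqrt : √((T + 1 : ℕ) : ℝ) ≤ 2 * r ^ 3 := by
    rw [Real.sqrt_le_left (by positivity)]
    push_cast
    rw [← hr4]
    have h1 : r ^ 4 ≤ r ^ 6 := pow_le_pow_right₀ hr1 (by norm_num)
    have h2 : 1 ≤ r ^ 6 := one_le_pow₀ hr1
    nlinarith
  have hsub : ∑ t ∈ Finset.Icc 1 T, sqDist (x t) y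
      ≤ ∑ t ∈ Finset.range (T + 1), sqDist (x t) y := by
    refine Finset.sum_le_sum_of_subset_of_nonneg (fun t ht => ?_)
      fun t _ _ => Finset.sum_nonneg fun i _ => sq_nonneg _
    rw [Finset.mem_Icc] at ht
    exact Finset.mem_range.2 (by omega)
  have h1 : c * ∑ t ∈ Finset.Icc 1 T, sqDist (x t) y ≤ (3 * C + 2 * R) * r ^ 3 * (1 + L) := by
    calc _ ≤ c * ∑ t ∈ Finset.range (T + 1), sqDist (x t) y :=
          mul_le_mul_of_nonneg_left hsub hc.le
      _ ≤ C * (1 + 2 * r ^ 3) + R * (2 * r ^ 3) * (L + 1 / 2) := by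
          refine h.trans ?_
          gcongr
      _ ≤ C * (3 * r ^ 3) * (1 + L) + R * (2 * r ^ 3) * (1 + L) := by
          refine add_le_add ?_ (mul_le_mul_of_nonneg_left (by linarith) (by positivity))
          calc C * (1 + 2 * r ^ 3) ≤ C * (3 * r ^ 3) :=
                mul_le_mul_of_nonneg_left (by linarith) hC
            _ ≤ C * (3 * r ^ 3) * (1 + L) :=
                le_mul_of_one_le_right (by positivity) (by linarith)
      _ = _ := by ring
  refine (sqDist_avgDecision_le x y hT).trans ?_
  rw [← hr4]
  calc 1 / r ^ 4 * ∑ t ∈ Finset.Icc 1 T, sqDist (x t) y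
      = 1 / (c * r ^ 4) * (c * ∑ t ∈ Finset.Icc 1 T, sqDist (x t) y) := by field_simp
    _ ≤ 1 / (c * r ^ 4) * ((3 * C + 2 * R) * r ^ 3 * (1 + L)) :=
        mul_le_mul_of_nonneg_left h1 (by positivity)
    _ = _ := by field_simp

/-- The tail of the accumulated gradient noise along a run with sampled gradients. -/
lemma measure_sum_gradientNoise_ge_le {Γ : AggGame N n m d} (hΓ : Γ.Regular) {B : ℝ}
    (hB : Γ.BoundedBy B) {F : ∀ i, ℕ → Vec (d i) → Vec n → Vec (k i) → ℝ}
    (hF : ∀ i t, Measurable fun w : Vec (d i) × Vec n × Vec (k i) => F i t w.1 w.2.1 w.2.2)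
    (hd : ∀ i t, ∀ x ∈ Γ.X i, ∀ (y : Vec n) (ζ : Vec (k i)),
      DifferentiableAt ℝ (fun w : Vec (d i) × Vec n => F i t w.1 w.2 ζ) (x, y))
    (W : ℕ → Matrix (Fin N) (Fin N) ℝ) (α β γ : ℕ → ℝ) {ι S : ℝ} (hS : 0 ≤ S)
    {Ω : Type*} [MeasurableSpace Ω] {P : Measure Ω} [IsProbabilityMeasure P]
    {ξ : ∀ i, ℕ → Ω → Vec (k i)} (hξ : ∀ i t, Measurable (ξ i t))
    (hs : SamplingAssumption Γ F ι S P ξ) {x0 : Joint d} (hx0 : ∀ i, x0 i ∈ Γ.X i)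
    {xs : Joint d} (hxs : ∀ i, xs i ∈ Γ.X i) :
    (∀ᵐ ω ∂P, ∀ t i, ‖runGradient Γ F W (pdRun Γ F W α β γ x0 fun i s => ξ i s ω)
      (fun i s => ξ i s ω) t i‖ ≤ S) ∧
    ∀ (T : ℕ) (δ : ℝ), 0 < T → 0 < δ →
      P.real {ω | (2 * (N * (S * B)) + 1) * √T * (Real.log (1 / δ) + 1 / 2)
        ≤ ∑ t ∈ Finset.range T, IsPrimalDualRun.gradientNoise Γ W
          (runGradient Γ F W (pdRun Γ F W α β γ x0 fun i s => ξ i s ω) fun i s => ξ i s ω)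
          (pdRun Γ F W α β γ x0 fun i s => ξ i s ω) xs t} ≤ δ := by
  have hB0 := hB.nonneg
  have hle := sampleSigma_le hξ
  have hmeas := pdRun_isMeasurable hΓ hF hd W α β γ hx0 ξ
  set st : Ω → ℕ → PDState n m d := fun ω => pdRun Γ F W α β γ x0 fun i s => ξ i s ω with hst
  have hX : ∀ t ω i, (st ω t).x i ∈ Γ.X i := fun t ω i =>
    pdRun_x_mem hΓ F W α β γ hx0 _ t i
  set y : ∀ t, ∀ _i : Fin N, Ω → Vec n := fun t i ω =>
    pushSum (W t) (fun i => ∑ j, W t i j * (st ω t).z j) (st ω t).sig i with hy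
  set q : ∀ t, ∀ i : Fin N, Ω → Vec (d i) := fun t i ω =>
    sampledGrad Γ F i t ((st ω t).x i) (y t i ω) (ξ i t ω) with hq
  have hxm : ∀ t i, Measurable[sampleSigma ξ t] fun ω => (st ω t).x i := fun t i =>
    @PDState.IsMeasurable.x Ω (sampleSigma ξ t) N n m d _ (hmeas t) i
  have hym : ∀ t i, Measurable[sampleSigma ξ t] (y t i) := fun t i =>
    @PDState.IsMeasurable.pushSum_sig Ω (sampleSigma ξ t) N n m d _ (hmeas t) (W t) i
  have hqm : ∀ t i, Measurable[sampleSigma ξ (t + 1)] (q t i) := fun t i =>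
    @measurable_sampledGrad Ω (sampleSigma ξ (t + 1)) N n m d k Γ F i t (hF i t) (hd i t) _ _ _
      ((hxm t i).mono (sampleSigma_mono ξ (Nat.le_succ t)) le_rfl)
      ((hym t i).mono (sampleSigma_mono ξ (Nat.le_succ t)) le_rfl)
      (measurable_sampleSigma_succ ξ i t) fun ω => hX t ω i
  have hqS : ∀ t i, ∀ᵐ ω ∂P, ‖q t i ω‖ ≤ S := fun t i =>
    hs.bounded t i _ _ (hxm t i) (hym t i) fun ω => hX t ω i
  have hqall : ∀ᵐ ω ∂P, ∀ t i, ‖q t i ω‖ ≤ S :=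
    ae_all_iff.2 fun t => ae_all_iff.2 fun i => hqS t i
  refine ⟨hqall, fun T δ hT hδ => ?_⟩
  set v : ∀ t, ∀ i : Fin N, Ω → Vec (d i) := fun t i ω => xs i - (st ω t).x i with hv
  have hvm : ∀ t i, Measurable[sampleSigma ξ t] (v t i) := fun t i =>
    (hxm t i).const_sub (xs i)
  have hvB : ∀ t i ω, ‖v t i ω‖ ≤ B := fun t i ω => hB.diam_le i _ (hxs i) _ (hX t ω i)
  set Y : ℕ → Ω → ℝ := fun t ω => ∑ i, inner ℝ (q t i ω) (v t i ω) with hY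
  have hYm : ∀ t, StronglyMeasurable[sampleSigma ξ (t + 1)] (Y t) := fun t =>
    Finset.stronglyMeasurable_fun_sum _ fun i _ =>
      (hqm t i).stronglyMeasurable.inner
        ((hvm t i).mono (sampleSigma_mono ξ (Nat.le_succ t)) le_rfl).stronglyMeasurable
  have hYi : ∀ t i, ∀ᵐ ω ∂P, |(inner ℝ (q t i ω) (v t i ω) : ℝ)| ≤ S * B := fun t i => by
    filter_upwards [hqS t i] with ω hω
    exact (abs_real_inner_le_norm _ _).trans (mul_le_mul hω (hvB t i ω) (norm_nonneg _) hS)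
  have hYb : ∀ t, ∀ᵐ ω ∂P, |Y t ω| ≤ N * (S * B) := fun t => by
    filter_upwards [ae_all_iff.2 (hYi t)] with ω hω
    refine (Finset.abs_sum_le_sum_abs _ _).trans ((Finset.sum_le_sum fun i _ => hω i).trans ?_)
    simp
  have hYint : ∀ t, Integrable (Y t) P := fun t =>
    Integrable.of_bound (C := N * (S * B)) ((hYm t).mono (hle _)).aestronglyMeasurable (hYb t)
  -- The tail bound is applied to this version, adapted by construction; the noise equals it almost
  -- surely. Its bound is twice that of `Y`, and the extra 1 in the constant keeps it positive even
  -- when `N * (S * B)` vanishes.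
  set D : ℕ → Ω → ℝ := fun t => Y t - P[Y t | sampleSigma ξ t] with hD
  have htail := measure_sum_ge_le_of_bounded_differences (P := P) (D := D)
    (R := 2 * (N * (S * B)) + 1) hle (fun s t h => sampleSigma_mono ξ h) (by positivity)
    (fun t => (hYm t).sub
      (stronglyMeasurable_condExp.mono (sampleSigma_mono ξ (Nat.le_succ t))))
    (fun t => by
      filter_upwards [ae_abs_sub_condExp_le (sampleSigma ξ t) (hYb t)] with ω hω
      exact hω.trans (by linarith))
    (fun t => condExp_sub_condExp_self (hle t) (hYint t)) hδ hT
  have hnoise : ∀ t, ∀ᵐ ω ∂P, IsPrimalDualRun.gradientNoise Γ W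
      (runGradient Γ F W (st ω) fun i s => ξ i s ω) (st ω) xs t = D t ω := by
    intro t
    have h1 : ∀ i, ∀ᵐ ω ∂P, (inner ℝ (q t i ω - Γ.p i ((st ω t).x i) (y t i ω)) (v t i ω) : ℝ)
        = inner ℝ (q t i ω) (v t i ω)
          - (P[fun ω => inner ℝ (q t i ω) (v t i ω) | sampleSigma ξ t]) ω := fun i =>
      inner_sub_ae_eq_sub_condExp (hle t) ((hqm t i).mono (hle _) le_rfl) (hqS t i)
        (hs.unbiased t i _ _ (hxm t i) (hym t i) fun ω => hX t ω i) (hvm t i) (hvB t i)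
    have h2 := condExp_finsetSum (μ := P) (s := Finset.univ)
      (f := fun i ω => (inner ℝ (q t i ω) (v t i ω) : ℝ))
      (fun i _ => Integrable.of_bound (C := S * B)
        (((hqm t i).mono (hle _) le_rfl).inner
          ((hvm t i).mono (hle _) le_rfl)).aestronglyMeasurable (hYi t i)) (sampleSigma ξ t)
    have h3 : (∑ i, fun ω => (inner ℝ (q t i ω) (v t i ω) : ℝ)) = Y t := by
      ext ω
      simp [hY]
    rw [h3] at h2
    filter_upwards [ae_all_iff.2 h1, h2] with ω e1 e2
    have e3 : IsPrimalDualRun.gradientNoise Γ W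
        (runGradient Γ F W (st ω) fun i s => ξ i s ω) (st ω) xs t
        = ∑ i, inner ℝ (q t i ω - Γ.p i ((st ω t).x i) (y t i ω)) (v t i ω) := rfl
    rw [e3, Finset.sum_congr rfl fun i _ => e1 i, Finset.sum_sub_distrib]
    simp only [hD, Pi.sub_apply, e2, Finset.sum_apply]
    rfl
  refine le_trans (le_of_eq ?_) htail
  refine measureReal_congr (Filter.eventuallyEq_set.2 ?_)
  filter_upwards [ae_all_iff.2 hnoise] with ω hω
  have : ∑ t ∈ Finset.range T, IsPrimalDualRun.gradientNoise Γ W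
      (runGradient Γ F W (st ω) fun i s => ξ i s ω) (st ω) xs t
      = ∑ t ∈ Finset.range T, D t ω := Finset.sum_congr rfl fun t _ => hω t
  exact ⟨fun h => le_of_le_of_eq h this, fun h => le_of_le_of_eq h this.symm⟩

end Assembly

/-! ### The high-probability bound. -/

theorem corollary2 {N n m : ℕ} {d : Fin N → ℕ}
    (Γ : AggGame N n m d) (hΓ : Γ.Regular) (hLip : Γ.LipschitzInAgg) (hMono : Γ.StronglyMonotone)
    (W : ℕ → Matrix (Fin N) (Fin N) ℝ) (hW : GraphAssumption W)
    (ι S : ℝ) (hι : 0 < ι) (hS : 0 < S)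
    (xstar : Joint d) (hx : Γ.IsVGNE xstar) :
    ∃ C : ℝ, ∀ (k : Fin N → ℕ) (F : ∀ i, ℕ → Vec (d i) → Vec n → Vec (k i) → ℝ)
      (Ω₀ : Fin N → Type*) [∀ i, MeasurableSpace (Ω₀ i)]
      (P₀ : ∀ i, MeasureTheory.Measure (Ω₀ i)) [∀ i, MeasureTheory.IsProbabilityMeasure (P₀ i)]
      (ξ₀ : ∀ i, Ω₀ i → Vec (k i))
      (Ω : Type*) [MeasurableSpace Ω]
      (P : MeasureTheory.Measure Ω) [MeasureTheory.IsProbabilityMeasure P]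
      (ξ : ∀ i, ℕ → Ω → Vec (k i)) (x0 : Joint d),
      IsExpectedCost Γ F P₀ ξ₀ →
      (∀ i t, Measurable (ξ i t)) →
      (∀ i t, ProbabilityTheory.IdentDistrib (ξ i t) (ξ₀ i) P (P₀ i)) →
      SamplingAssumption Γ F ι S P ξ →
      (∀ i, x0 i ∈ Γ.X i) →
      ∀ (T : ℕ) (δ : ℝ), 1 ≤ T → 0 < δ → δ < 1 →
        ENNReal.ofReal (1 - δ) ≤
          P {ω | sqDist
              (avgDecision
                (fun t => (pdRun Γ F W (polyStep (3 / 4)) (polyStep (1 / 4)) (polyStep (1 / 4))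
                  x0 (fun i s => ξ i s ω) t).x) T)
              xstar
            ≤ C * ((T : ℝ) ^ (-(1 / 4) : ℝ) + (T : ℝ) ^ (-(1 / 4) : ℝ) * Real.log (1 / δ))} := by
  obtain ⟨B, hB⟩ := hΓ.exists_boundedBy
  have hB0 := hB.nonneg
  obtain ⟨c, C, hc, hC, hreg⟩ := AggGame.exists_regret_bound hΓ hLip hMono hW
    isSlowStep_polyStep hS.le hx
  set R : ℝ := 2 * (N * (S * B)) + 1 with hR
  refine ⟨(3 * C + 2 * R) / c, ?_⟩
  intro k F Ω₀ _ P₀ _ ξ₀ Ω _ P _ ξ x0 hcost hξ _ hs hx0 T δ hT hδ hδ1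
  have hL : 0 ≤ Real.log (1 / δ) := Real.log_nonneg (by rw [le_div_iff₀ hδ]; linarith)
  obtain ⟨hbdd, htail⟩ := measure_sum_gradientNoise_ge_le hΓ hB hcost.meas_F hcost.diff_F W
    (polyStep (3 / 4)) (polyStep (1 / 4)) (polyStep (1 / 4)) hS.le hξ hs hx0 hx.1.1.1
  have hbad := htail (T + 1) δ (Nat.succ_pos T) hδ
  set X : Ω → ℝ := fun ω => ∑ t ∈ Finset.range (T + 1), IsPrimalDualRun.gradientNoise Γ W
    (runGradient Γ F W (pdRun Γ F W (polyStep (3 / 4)) (polyStep (1 / 4)) (polyStep (1 / 4)) x0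
      fun i s => ξ i s ω) fun i s => ξ i s ω)
    (pdRun Γ F W (polyStep (3 / 4)) (polyStep (1 / 4)) (polyStep (1 / 4)) x0
      fun i s => ξ i s ω) xstar t
  set a : ℝ := R * √((T + 1 : ℕ) : ℝ) * (Real.log (1 / δ) + 1 / 2)
  set bad : Set Ω := {ω | a ≤ X ω}
  have h1 : 1 - ENNReal.ofReal δ ≤ P badᶜ := by
    have h2 : P bad ≤ ENNReal.ofReal δ := by
      rw [← ENNReal.ofReal_toReal (measure_ne_top P bad)]
      exact ENNReal.ofReal_le_ofReal hbad
    -- Subadditivity suffices here, so the bad event need not be shown measurable.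
    have h3 : (1 : ENNReal) ≤ P bad + P badᶜ := by
      rw [← measure_univ (μ := P), ← Set.union_compl_self bad]
      exact measure_union_le _ _
    exact tsub_le_iff_left.2 (h3.trans (add_le_add h2 le_rfl))
  rw [ENNReal.ofReal_sub _ hδ.le, ENNReal.ofReal_one]
  -- The inclusion holds off the null set where some sampled gradient exceeds `S`, since the
  -- pathwise bound needs that estimate at all times.
  refine h1.trans (measure_mono_ae ?_)
  filter_upwards [hbdd] with ω hω hgood
  have hnoise : X ω < a := not_le.1 (show ¬a ≤ X ω from hgood)
  refine rate_of_regret hc hC (by positivity) hL hT ?_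
  refine (hreg _ _ (pdRun_isPrimalDualRun hΓ F W hx0 _) hω T).trans ?_
  exact add_le_add le_rfl hnoise.le
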